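/- Let $\lambda, P, r_0 > 0$, $N_0 \ge 0$ and $\eta > 2$. Consider a single-tier downlink cellular network seen from a user at the origin of $\mathbb{R}^2$ that is served by its nearest base station (BS), located at distance $r_0$. The interfering BSs $x_1, x_2, \dots$ (all BSs other than the serving one; universal frequency reuse, no intra-cell interference) form a Poisson point process of intensity $\lambda$ on $\{x \in \mathbb{R}^2 : \|x\| > r_0\}$. All BSs transmit with power $P$, the path-loss is $r^{-\eta}$, the noise power is $N_0$, and the fading is Rayleigh: the channel coefficients $h_0$ (serving BS) and $h_1, h_2, \dots$ (interfering BSs) are i.i.d. $\mathcal{CN}(0,1)$ and independent of the BS locations. Put $$\mathcal{I} = \sum_{k \ge 1} P |h_k|^2 \|x_k\|^{-\eta}, \qquad \Upsilon = \frac{P |h_0|^2 r_0^{-\eta}}{\mathcal{I} + N_0}.$$ Then $\mathcal{I} < \infty$ almost surely, and the following hold, where ${}_2F_1(a,b;c;\cdot)$ is the Gauss hypergeometric function, continued analytically to $\mathbb{C} \setminus [1,\infty)$, and $\log$ is the natural logarithm. (i) For every threshold $T \ge 0$ the outage probability $\mathcal{O}(r_0, T) = \mathbb{P}\{\Upsilon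 < T\}$ equals $$1 - \exp\left\{-\frac{T N_0 r_0^{\eta}}{P} - \frac{2\pi\lambda T r_0^2}{\eta - 2}\, {}_2F_1\left(1, 1 - \tfrac{2}{\eta}; 2 - \tfrac{2}{\eta}; -T\right)\right\},$$ and for $\eta = 4$ it equals $$1 - \exp\left\{-\frac{T N_0 r_0^{4}}{P} - \pi\lambda\sqrt{T}\, r_0^2 \arctan(\sqrt{T})\right\}.$$ (ii) $\log(1 + \Upsilon)$ is integrable, and the ergodic rate $\mathcal{C}(r_0) = \mathbb{E}\{\log(1 + \Upsilon)\}$ equals the convergent integral $$\int_0^\infty \frac{1}{t + 1} \exp\left\{-\frac{t N_0 r_0^{\eta}}{P} - \frac{2\pi\lambda t r_0^2}{\eta - 2}\, {}_2F_1\left(1, 1 - \tfrac{2}{\eta}; 2 - \tfrac{2}{\eta}; -t\right)\right\} dt,$$ and for $\eta = 4$ it equals $$\int_0^\infty \frac{1}{t + 1} \exp\left\{-\frac{t N_0 r_0^{4}}{P} - \pi\lambda\sqrt{t}\, r_0^2 \arctan(\sqrt{t})\right\} dt.$$ -/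

import Mathlib

open MeasureTheory ProbabilityTheory Set

/-! ### The Gauss hypergeometric function -/

/-- The plane cut along `[1, ∞)`, the domain of the principal branch of `₂F₁`. -/
def hypergeometricDomain : Set ℂ := {z | 1 - z ∈ Complex.slitPlane}

/-- `F` is the principal branch of `₂F₁(a, b; c; ·)`: it is analytic on `ℂ ∖ [1, ∞)`, and on the
open unit disc it is the sum of the Gauss series `∑ (a)ₙ (b)ₙ / ((c)ₙ n!) zⁿ`. -/
def IsHypergeometricBranch (a b c : ℂ) (F : ℂ → ℂ) : Prop :=
  AnalyticOnNhd ℂ F hypergeometricDomain ∧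
    EqOn F (ordinaryHypergeometric a b c) (Metric.ball 0 1)

open Classical in
/-- The Gauss hypergeometric function `₂F₁(a, b; c; z)`, `z ∈ ℂ ∖ [1, ∞)`: the analytic
continuation of the Gauss series (unique by `IsHypergeometricBranch.eqOn`). -/
noncomputable def hyp2F1 (a b c z : ℂ) : ℂ :=
  if h : ∃ F, IsHypergeometricBranch a b c F then h.choose z else 0

/-- `₂F₁(a, b; c; x)` for real parameters and real `x < 1`. -/
noncomputable def realHyp2F1 (a b c x : ℝ) : ℝ := (hyp2F1 a b c x).re

theorem isOpen_hypergeometricDomain : IsOpen hypergeometricDomain :=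
  Complex.isOpen_slitPlane.preimage (continuous_const.sub continuous_id)

theorem isPreconnected_hypergeometricDomain : IsPreconnected hypergeometricDomain := by
  have h : hypergeometricDomain = (fun z : ℂ => 1 - z) '' Complex.slitPlane := by
    ext z
    constructor
    · intro hz
      exact ⟨1 - z, hz, by ring⟩
    · rintro ⟨w, hw, rfl⟩
      simpa [hypergeometricDomain] using hw
  rw [h]
  exact (Complex.starConvex_one_slitPlane.isPathConnected
    Complex.one_mem_slitPlane).isConnected.isPreconnected.image _ (by fun_prop)

theorem zero_mem_hypergeometricDomain : (0 : ℂ) ∈ hypergeometricDomain := by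
  simp [hypergeometricDomain]

/-- The principal branch is unique. -/
theorem IsHypergeometricBranch.eqOn {a b c : ℂ} {F G : ℂ → ℂ}
    (hF : IsHypergeometricBranch a b c F) (hG : IsHypergeometricBranch a b c G) :
    EqOn F G hypergeometricDomain := by
  refine hF.1.eqOn_of_preconnected_of_eventuallyEq hG.1 isPreconnected_hypergeometricDomain
    zero_mem_hypergeometricDomain ?_
  filter_upwards [Metric.ball_mem_nhds (0 : ℂ) one_pos] with z hz
  rw [hF.2 hz, hG.2 hz]

/-! ### Poisson point processes -/

/-- The number of points of the point configuration `(X k ω)ₖ` that lie in `B`. -/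
noncomputable def pointCount {Ω E : Type*} (X : ℕ → Ω → E) (B : Set E) (ω : Ω) : ℕ∞ :=
  {k : ℕ | X k ω ∈ B}.encard

/-- The point process `{X k ; k ∈ ℕ}` is a Poisson point process with intensity measure `Λ`: the
number of points in a measurable set `B` with `Λ B < ∞` has the Poisson distribution with mean
`Λ B`, and the numbers of points in finitely many disjoint measurable sets are independent. -/
structure IsPoissonPointProcess {Ω E : Type*} [MeasurableSpace Ω] [MeasurableSpace E]
    (X : ℕ → Ω → E) (Λ : Measure E) (μ : Measure Ω) : Prop where
  measurable : ∀ k, Measurable (X k)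
  poisson : ∀ B : Set E, MeasurableSet B → Λ B ≠ ⊤ →
    μ.map (pointCount X B) = (poissonMeasure (Λ B).toNNReal).map (fun n : ℕ => (n : ℕ∞))
  indep : ∀ (n : ℕ) (B : Fin n → Set E), (∀ i, MeasurableSet (B i)) →
    (Pairwise fun i j => Disjoint (B i) (B j)) → iIndepFun (fun i => pointCount X (B i)) μ

/-! ### The downlink network -/

/-- The circularly symmetric complex Gaussian distribution `CN(0, 1)`: independent real and
imaginary parts with distribution `N(0, 1/2)`. -/
noncomputable def stdComplexGaussian : Measure ℂ :=
  ((gaussianReal 0 (1 / 2)).prod (gaussianReal 0 (1 / 2))).map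
    fun p : ℝ × ℝ => (⟨p.1, p.2⟩ : ℂ)

/-- The downlink network seen from a user at the origin. `X k` is the location of the `k`-th base
station and `h k` its channel coefficient to the user. The serving (nearest) base station is `X 0`,
at distance `r₀`; the interfering base stations `X 1, X 2, …` form a Poisson point process of
intensity `lam` outside the disc of radius `r₀` around the user (nearest base station association).
The fading is Rayleigh: the `h k` are i.i.d. `CN(0, 1)` and independent of the locations. -/
structure IsDownlinkNetwork {Ω : Type*} [MeasurableSpace Ω] (μ : Measure Ω) (lam r₀ : ℝ)
    (X : ℕ → Ω → EuclideanSpace ℝ (Fin 2)) (h : ℕ → Ω → ℂ) : Prop where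
  measurable_serving : Measurable (X 0)
  serving_distance : ∀ᵐ ω ∂μ, ‖X 0 ω‖ = r₀
  interferers : IsPoissonPointProcess (fun k => X (k + 1))
    (ENNReal.ofReal lam • (volume : Measure (EuclideanSpace ℝ (Fin 2))).restrict
      {x | r₀ < ‖x‖}) μ
  measurable_fading : ∀ k, Measurable (h k)
  rayleigh : ∀ k, μ.map (h k) = stdComplexGaussian
  indep_fading : iIndepFun h μ
  indep_locations : IndepFun (fun ω k => X k ω) (fun ω k => h k ω) μ

/-- Power received from the `k`-th base station: transmit power `P`, path-loss exponent `η`. -/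
noncomputable def receivedPower {Ω : Type*} (P η : ℝ) (X : ℕ → Ω → EuclideanSpace ℝ (Fin 2))
    (h : ℕ → Ω → ℂ) (k : ℕ) (ω : Ω) : ℝ :=
  P * ‖h k ω‖ ^ 2 * ‖X k ω‖ ^ (-η)

/-- Aggregate interference power: with universal frequency reuse every base station other than the
serving one interferes, and without intra-cell interference nothing else does. -/
noncomputable def interference {Ω : Type*} (P η : ℝ) (X : ℕ → Ω → EuclideanSpace ℝ (Fin 2))
    (h : ℕ → Ω → ℂ) (ω : Ω) : ℝ :=
  ∑' k : ℕ, receivedPower P η X h (k + 1) ω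

/-- Signal-to-interference-plus-noise ratio, with noise power `N₀`. -/
noncomputable def sinr {Ω : Type*} (P N₀ η : ℝ) (X : ℕ → Ω → EuclideanSpace ℝ (Fin 2))
    (h : ℕ → Ω → ℂ) (ω : Ω) : ℝ :=
  receivedPower P η X h 0 ω / (interference P η X h ω + N₀)

/-- Outage probability `ℙ(SINR < T)`. -/
noncomputable def outageProbability {Ω : Type*} [MeasurableSpace Ω] (μ : Measure Ω)
    (P N₀ η : ℝ) (X : ℕ → Ω → EuclideanSpace ℝ (Fin 2)) (h : ℕ → Ω → ℂ) (T : ℝ) : ℝ :=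
  μ.real {ω | sinr P N₀ η X h ω < T}

/-- Ergodic rate per unit bandwidth, in nats: `𝔼[log (1 + SINR)]`. -/
noncomputable def ergodicRate {Ω : Type*} [MeasurableSpace Ω] (μ : Measure Ω)
    (P N₀ η : ℝ) (X : ℕ → Ω → EuclideanSpace ℝ (Fin 2)) (h : ℕ → Ω → ℂ) : ℝ :=
  ∫ ω, Real.log (1 + sinr P N₀ η X h ω) ∂μ

/-!
The signal-to-interference-plus-noise ratio `Υ` is at least `T` exactly when the fading gain
`|h₀|²` of the serving station is at least `T N₀ r₀^η / P + ∑ T r₀^η ‖xₖ‖^(-η) |hₖ|²`. Under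
Rayleigh fading the gains `|hₖ|²` are exponential with mean `1`
(`lintegral_stdComplexGaussian_comp_norm_sq`), so `ℙ(W ≤ |h₀|²) = 𝔼[exp (-W)]` for every `W ≥ 0`
independent of `h₀` (`measure_le_eq_lintegral_expNeg`). For fixed locations the fading of each
interferer is integrated out separately and contributes the factor `1 / (1 + T r₀^η ‖xₖ‖^(-η))`
(`measure_add_tsum_le_norm_sq`).

The product of these factors is `exp (-∑ f (xₖ))` with `f = log (1 + T r₀^η ‖·‖^(-η))`, so its
expectation over the locations is the Laplace functional `exp (-∫ (1 - e⁻ᶠ) dΛ)` of the Poisson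
process (`IsPoissonPointProcess.lintegral_expNeg_tsum`). That functional is computed for simple
functions from the independence of the counts of disjoint sets and extended by monotone limits. In
polar coordinates the integral becomes Euler's integral
`∫₀¹ b vᵇ⁻¹ / (1 + T v) dv = ₂F₁(1, b; b + 1; -T)`, `b = 1 - 2 / η`
(`lintegral_interferers_one_sub_expNeg`). Euler's integral is analytic on the plane cut along
`[1, ∞)` and has the Gauss series as its expansion at `0`, so it is the principal branch
(`isHypergeometricBranch_eulerIntegral`). For `η = 4` it is elementary.

All sums and expectations are taken in `[0, ∞]`, so this computation presupposes no convergence.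
Letting `T → 0` shows that the interference is almost surely finite, and letting `T → ∞` that it is
almost surely positive, so that `Υ` is a genuine quotient also when `N₀ = 0`. The ergodic rate
follows from the layer cake formula `𝔼[log (1 + Υ)] = ∫₀^∞ ℙ(Υ ≥ t) / (1 + t) dt`. The integral
converges because the exponent grows at least logarithmically
(`mul_log_one_add_le_mul_realHyp2F1`).
-/

open scoped ENNReal NNReal Topology

/-! ### The negative exponential on `[0, ∞]` -/

/-- The map `x ↦ e⁻ˣ` from `[0, ∞]` to `[0, ∞]`, with `e⁻ˣ = 0` at `x = ∞`. -/
noncomputable def expNeg (x : ℝ≥0∞) : ℝ≥0∞ := EReal.exp (-(x : EReal))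

theorem continuous_expNeg : Continuous expNeg :=
  ENNReal.continuous_exp.comp (continuous_neg.comp continuous_coe_ennreal_ereal)

theorem measurable_expNeg : Measurable expNeg := continuous_expNeg.measurable

@[simp] theorem expNeg_zero : expNeg 0 = 1 := by simp [expNeg]

@[simp] theorem expNeg_top : expNeg ⊤ = 0 := by simp [expNeg]

theorem expNeg_antitone : Antitone expNeg := fun _ _ hxy =>
  EReal.exp_monotone (EReal.neg_le_neg_iff.2 (EReal.coe_ennreal_le_coe_ennreal_iff.2 hxy))

theorem expNeg_le_one (x : ℝ≥0∞) : expNeg x ≤ 1 :=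
  expNeg_zero ▸ expNeg_antitone zero_le

theorem expNeg_ne_top (x : ℝ≥0∞) : expNeg x ≠ ⊤ :=
  ((expNeg_le_one x).trans_lt ENNReal.one_lt_top).ne

theorem expNeg_ofReal {x : ℝ} (hx : 0 ≤ x) :
    expNeg (ENNReal.ofReal x) = ENNReal.ofReal (Real.exp (-x)) := by
  rw [expNeg, EReal.coe_ennreal_ofReal, max_eq_left hx, ← EReal.coe_neg, EReal.exp_coe]

theorem expNeg_add (x y : ℝ≥0∞) : expNeg (x + y) = expNeg x * expNeg y := by
  rw [expNeg, EReal.coe_ennreal_add, EReal.neg_add (Or.inl (EReal.coe_ennreal_ne_bot x))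
    (Or.inr (EReal.coe_ennreal_ne_bot y)), sub_eq_add_neg, EReal.exp_add]
  rfl

theorem expNeg_sum {ι : Type*} (s : Finset ι) (f : ι → ℝ≥0∞) :
    expNeg (∑ i ∈ s, f i) = ∏ i ∈ s, expNeg (f i) := by
  classical
  induction s using Finset.induction_on with
  | empty => simp
  | insert a s ha ih => rw [Finset.sum_insert ha, Finset.prod_insert ha, expNeg_add, ih]

theorem expNeg_mul_natCast (v : ℝ≥0∞) (n : ℕ) : expNeg (v * n) = expNeg v ^ n := by
  rw [mul_comm, ← nsmul_eq_mul, ← Finset.card_range n, ← Finset.sum_const, expNeg_sum,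
    Finset.prod_const, Finset.card_range]

/-! ### The Laplace functional of a Poisson point process -/

/-- Laplace transform of the Poisson distribution. -/
theorem lintegral_expNeg_mul_poissonMeasure (v : ℝ≥0∞) (r : ℝ≥0) :
    ∫⁻ n : ℕ, expNeg (v * n) ∂poissonMeasure r = expNeg ((1 - expNeg v) * r) := by
  set q : ℝ := (expNeg v).toReal with hq
  have hq' : expNeg v = ENNReal.ofReal q := (ENNReal.ofReal_toReal (expNeg_ne_top v)).symm
  have hq0 : 0 ≤ q := ENNReal.toReal_nonneg
  have hq1 : q ≤ 1 := ENNReal.toReal_le_of_le_ofReal zero_le_one (by simpa using expNeg_le_one v)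
  rw [poissonMeasure, lintegral_sum_measure]
  have hterm : ∀ n : ℕ, ∫⁻ k : ℕ, expNeg (v * k)
      ∂(ENNReal.ofReal (Real.exp (-r) * r ^ n / n.factorial) • Measure.dirac n) =
      ENNReal.ofReal (Real.exp (-r) * ((q * r) ^ n / n.factorial)) := by
    intro n
    rw [lintegral_smul_measure, lintegral_dirac, expNeg_mul_natCast, hq', smul_eq_mul,
      ← ENNReal.ofReal_pow hq0, ← ENNReal.ofReal_mul (by positivity)]
    congr 1
    rw [mul_pow]
    ring
  have hs : HasSum (fun n : ℕ => Real.exp (-r) * ((q * r) ^ n / n.factorial))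
      (Real.exp (-r) * Real.exp (q * r)) := by
    have := NormedSpace.expSeries_div_hasSum_exp (q * (r : ℝ))
    rw [← Real.exp_eq_exp_ℝ] at this
    exact this.mul_left _
  rw [tsum_congr hterm, ← ENNReal.ofReal_tsum_of_nonneg (fun n => by positivity) hs.summable,
    hs.tsum_eq, hq', ← ENNReal.ofReal_one, ← ENNReal.ofReal_sub _ hq0, ← ENNReal.ofReal_coe_nnreal,
    ← ENNReal.ofReal_mul (by linarith), expNeg_ofReal (mul_nonneg (by linarith) r.coe_nonneg),
    ← Real.exp_add]
  congr 2
  ring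

theorem tsum_indicator_eq_mul_pointCount {Ω E : Type*} (X : ℕ → Ω → E) (B : Set E)
    (v : ℝ≥0∞) (ω : Ω) :
    ∑' k, B.indicator (fun _ => v) (X k ω) = v * (pointCount X B ω : ℝ≥0∞) := by
  rw [pointCount, mul_comm, ← ENNReal.tsum_set_const, tsum_subtype {k | X k ω ∈ B} (fun _ => v)]
  rfl

section Laplace

variable {Ω E : Type*} [MeasurableSpace Ω] [MeasurableSpace E]

theorem measurable_pointCount {X : ℕ → Ω → E} (hX : ∀ k, Measurable (X k)) {B : Set E}
    (hB : MeasurableSet B) : Measurable (pointCount X B) := by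
  have h : Measurable fun ω => (pointCount X B ω : ℝ≥0∞) := by
    have : (fun ω => (pointCount X B ω : ℝ≥0∞)) =
        fun ω => ∑' k, B.indicator (fun _ => (1 : ℝ≥0∞)) (X k ω) := by
      funext ω
      rw [tsum_indicator_eq_mul_pointCount, one_mul]
    rw [this]
    exact Measurable.tsum fun k => (measurable_const.indicator hB).comp (hX k)
  refine measurable_to_countable' fun y => ?_
  convert h (measurableSet_singleton (y : ℝ≥0∞)) using 1
  ext ω
  simp

theorem SimpleFunc.eq_sum_indicator_filter (g : SimpleFunc E ℝ≥0∞) (x : E) :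
    g x = ∑ v ∈ g.range.filter (· ≠ 0), (g ⁻¹' {v}).indicator (fun _ => v) x := by
  by_cases hx : g x = 0
  · rw [hx]
    refine (Finset.sum_eq_zero fun v hv => indicator_of_notMem ?_ _).symm
    intro hv'
    exact (Finset.mem_filter.1 hv).2 (by simpa [hx] using hv'.symm)
  · rw [Finset.sum_eq_single (g x)]
    · simp
    · intro v _ hv
      exact indicator_of_notMem (fun h => hv h.symm) _
    · intro h
      simp [hx] at h

/-- The Laplace functional of a Poisson point process at a simple function `g` whose support has
finite intensity: the sum of `g` over the points is the combination `∑ v * N {g = v}` of independent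
Poisson variables. -/
theorem IsPoissonPointProcess.lintegral_expNeg_tsum_simpleFunc {μ : Measure Ω} {Λ : Measure E}
    {X : ℕ → Ω → E} (hX : IsPoissonPointProcess X Λ μ) (g : SimpleFunc E ℝ≥0∞)
    (hg : ∀ v ≠ 0, Λ (g ⁻¹' {v}) ≠ ⊤) :
    ∫⁻ ω, expNeg (∑' k, g (X k ω)) ∂μ = expNeg (∫⁻ x, (1 - expNeg (g x)) ∂Λ) := by
  set s := g.range.filter (· ≠ 0) with hs
  have hB : ∀ v, MeasurableSet (g ⁻¹' {v}) := fun v => g.measurableSet_preimage _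
  have hsum : ∀ ω, expNeg (∑' k, g (X k ω)) =
      ∏ v : s, expNeg (v * (pointCount X (g ⁻¹' {(v : ℝ≥0∞)}) ω : ℝ≥0∞)) := by
    intro ω
    rw [Finset.prod_coe_sort s (fun v => expNeg (v * (pointCount X (g ⁻¹' {v}) ω : ℝ≥0∞))),
      ← expNeg_sum]
    congr 1
    rw [tsum_congr fun k => SimpleFunc.eq_sum_indicator_filter g (X k ω),
      Summable.tsum_finsetSum fun _ _ => ENNReal.summable]
    exact Finset.sum_congr rfl fun v _ => tsum_indicator_eq_mul_pointCount X _ v ω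
  have hindep : iIndepFun (fun v : s => pointCount X (g ⁻¹' {(v : ℝ≥0∞)})) μ := by
    have := hX.indep s.card (fun i => g ⁻¹' {((s.equivFin.symm i : s) : ℝ≥0∞)}) (fun i => hB _)
      (fun i j hij => Disjoint.preimage _ <| by
        rw [disjoint_singleton]
        exact fun h => hij (s.equivFin.symm.injective (Subtype.ext h)))
    simpa using this.precomp s.equivFin.injective
  have hindep' : iIndepFun
      (fun (v : s) ω => expNeg (v * (pointCount X (g ⁻¹' {(v : ℝ≥0∞)}) ω : ℝ≥0∞))) μ :=
    hindep.comp (fun v n => expNeg (v * (n : ℝ≥0∞))) fun v => Measurable.of_discrete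
  have hmarg : ∀ v : s, ∫⁻ ω, expNeg (v * (pointCount X (g ⁻¹' {(v : ℝ≥0∞)}) ω : ℝ≥0∞)) ∂μ =
      expNeg ((1 - expNeg v) * Λ (g ⁻¹' {(v : ℝ≥0∞)})) := by
    intro v
    have hfin := hg v (Finset.mem_filter.1 v.2).2
    rw [← lintegral_map (f := fun n : ℕ∞ => expNeg (v * (n : ℝ≥0∞))) Measurable.of_discrete
      (measurable_pointCount hX.measurable (hB v)), hX.poisson _ (hB v) hfin,
      lintegral_map Measurable.of_discrete Measurable.of_discrete]
    simp only [ENat.toENNReal_coe]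
    rw [lintegral_expNeg_mul_poissonMeasure, ENNReal.coe_toNNReal hfin]
  rw [lintegral_congr hsum, lintegral_prod_eq_prod_lintegral_of_indepFun _ _ hindep'
    fun v => (Measurable.of_discrete (f := fun n : ℕ∞ => expNeg (v * (n : ℝ≥0∞)))).comp
      (measurable_pointCount hX.measurable (hB v)),
    Finset.prod_congr rfl fun v _ => hmarg v, ← expNeg_sum,
    Finset.sum_coe_sort s fun v => (1 - expNeg v) * Λ (g ⁻¹' {v})]
  congr 1
  have : (fun x => 1 - expNeg (g x)) = ⇑(g.map fun v => 1 - expNeg v) := by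
    ext x
    simp
  rw [this, SimpleFunc.lintegral_eq_lintegral, SimpleFunc.map_lintegral, hs, Finset.sum_filter]
  refine Finset.sum_congr rfl fun v _ => ?_
  by_cases hv : v = 0 <;> simp [hv]

/-- The Laplace functional of a Poisson point process with σ-finite intensity measure `Λ`: the
expectation of `exp (-∑ f (X k))` is `exp (-∫ (1 - e⁻ᶠ) dΛ)`. -/
theorem IsPoissonPointProcess.lintegral_expNeg_tsum {μ : Measure Ω} [IsFiniteMeasure μ]
    {Λ : Measure E} [SigmaFinite Λ]
    {X : ℕ → Ω → E} (hX : IsPoissonPointProcess X Λ μ) {f : E → ℝ≥0∞} (hf : Measurable f) :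
    ∫⁻ ω, expNeg (∑' k, f (X k ω)) ∂μ = expNeg (∫⁻ x, (1 - expNeg (f x)) ∂Λ) := by
  -- Increasing simple approximations of `f`, cut off to sets of finite intensity, where the
  -- Poisson law of the counts is available.
  set g : ℕ → SimpleFunc E ℝ≥0∞ := fun n => (SimpleFunc.eapprox f n).restrict (spanningSets Λ n)
    with hg
  have hgapp : ∀ n x, g n x = (spanningSets Λ n).indicator (SimpleFunc.eapprox f n) x :=
    fun n x => SimpleFunc.restrict_apply _ (measurableSet_spanningSets Λ n) x
  have hmono : ∀ x, Monotone fun n => g n x := by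
    intro x m n hmn
    simp only [hgapp]
    exact (indicator_le_indicator_of_subset (monotone_spanningSets Λ hmn)
      (fun _ => zero_le) x).trans
      (indicator_le_indicator (SimpleFunc.monotone_eapprox f hmn x))
  have hlim : ∀ x, Filter.Tendsto (fun n => g n x) Filter.atTop (𝓝 (f x)) := by
    intro x
    refine (SimpleFunc.tendsto_eapprox hf x).congr' ?_
    filter_upwards [Filter.eventually_ge_atTop (spanningSetsIndex Λ x)] with n hn
    rw [hgapp, indicator_of_mem]
    exact monotone_spanningSets Λ hn (mem_spanningSetsIndex Λ x)
  have hfin : ∀ n, ∀ v ≠ 0, Λ (g n ⁻¹' {v}) ≠ ⊤ := by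
    intro n v hv
    refine ((measure_mono ?_).trans_lt (measure_spanningSets_lt_top Λ n)).ne
    intro x hx
    by_contra hxn
    apply hv
    rw [mem_preimage, mem_singleton_iff, hgapp, indicator_of_notMem hxn] at hx
    exact hx.symm
  have h1 : Filter.Tendsto (fun n => ∫⁻ ω, expNeg (∑' k, g n (X k ω)) ∂μ) Filter.atTop
      (𝓝 (∫⁻ ω, expNeg (∑' k, f (X k ω)) ∂μ)) := by
    refine tendsto_lintegral_of_dominated_convergence (fun _ => 1) (fun n => ?_)
      (fun n => Filter.Eventually.of_forall fun ω => expNeg_le_one _) (by simp)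
      (Filter.Eventually.of_forall fun ω => ?_)
    · exact measurable_expNeg.comp
        (Measurable.tsum fun k => (g n).measurable.comp (hX.measurable k))
    · refine (continuous_expNeg.tendsto _).comp ?_
      simp only [← lintegral_count]
      exact lintegral_tendsto_of_tendsto_of_monotone (fun n => Measurable.of_discrete.aemeasurable)
        (Filter.Eventually.of_forall fun k => hmono _) (Filter.Eventually.of_forall fun k => hlim _)
  have h2 : Filter.Tendsto (fun n => expNeg (∫⁻ x, (1 - expNeg (g n x)) ∂Λ)) Filter.atTop
      (𝓝 (expNeg (∫⁻ x, (1 - expNeg (f x)) ∂Λ))) := by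
    refine (continuous_expNeg.tendsto _).comp ?_
    refine lintegral_tendsto_of_tendsto_of_monotone (fun n => ?_)
      (Filter.Eventually.of_forall fun x m n hmn => ?_) (Filter.Eventually.of_forall fun x => ?_)
    · exact (measurable_const.sub (measurable_expNeg.comp (g n).measurable)).aemeasurable
    · exact tsub_le_tsub_left (expNeg_antitone (hmono x hmn)) 1
    · exact ENNReal.Tendsto.sub tendsto_const_nhds
        ((continuous_expNeg.tendsto _).comp (hlim x)) (Or.inl ENNReal.one_ne_top)
  refine tendsto_nhds_unique h1 (h2.congr fun n => ?_)
  exact (hX.lintegral_expNeg_tsum_simpleFunc (g n) (hfin n)).symm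

end Laplace

/-! ### Radial integration in the plane and the Rayleigh distribution -/

theorem lintegral_Ioi_comp_sq_mul (F : ℝ → ℝ≥0∞) :
    ∫⁻ r in Ioi (0 : ℝ), ENNReal.ofReal (2 * r) * F (r ^ 2) = ∫⁻ u in Ioi (0 : ℝ), F u := by
  have himg : (fun r : ℝ => r ^ 2) '' Ioi 0 = Ioi 0 := by
    ext u
    constructor
    · rintro ⟨r, hr, rfl⟩
      exact pow_pos (mem_Ioi.1 hr) 2
    · intro hu
      exact ⟨√u, Real.sqrt_pos.2 hu, Real.sq_sqrt (le_of_lt hu)⟩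
  conv_rhs => rw [← himg]
  rw [lintegral_image_eq_lintegral_abs_deriv_mul measurableSet_Ioi
    (f' := fun r => 2 * r)
    (fun r _ => by simpa using (hasDerivAt_pow 2 r).hasDerivWithinAt)
    fun a ha b hb hab => (pow_left_inj₀ (le_of_lt ha) (le_of_lt hb) two_ne_zero).1 hab]
  refine setLIntegral_congr_fun measurableSet_Ioi fun r hr => ?_
  rw [abs_of_pos (mul_pos two_pos hr)]

/-- Integration of a function of the squared radius over the plane. -/
theorem lintegral_prod_comp_sq_add_sq {F : ℝ → ℝ≥0∞} (hF : Measurable F) :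
    ∫⁻ p : ℝ × ℝ, F (p.1 ^ 2 + p.2 ^ 2) =
      ENNReal.ofReal Real.pi * ∫⁻ u in Ioi (0 : ℝ), F u := by
  have hint : ∀ p : ℝ × ℝ, ENNReal.ofReal p.1 •
      F ((polarCoord.symm p).1 ^ 2 + (polarCoord.symm p).2 ^ 2) =
      ENNReal.ofReal p.1 * F (p.1 ^ 2) := by
    intro p
    rw [polarCoord_symm_apply, smul_eq_mul]
    congr 2
    linear_combination p.1 ^ 2 * Real.sin_sq_add_cos_sq p.2
  rw [← lintegral_comp_polarCoord_symm, lintegral_congr hint, polarCoord_target,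
    Measure.volume_eq_prod, ← Measure.prod_restrict,
    lintegral_prod _ (by fun_prop), ← lintegral_Ioi_comp_sq_mul F,
    ← lintegral_const_mul _ (by fun_prop)]
  refine lintegral_congr fun r => ?_
  dsimp only
  rw [lintegral_const, Measure.restrict_apply_univ, Real.volume_Ioo, mul_comm, ← mul_assoc,
    mul_comm 2 r, ENNReal.ofReal_mul' zero_le_two, sub_neg_eq_add, ← two_mul,
    ENNReal.ofReal_mul zero_le_two]
  ring

theorem lintegral_euclidean_comp_norm_sq {F : ℝ → ℝ≥0∞} (hF : Measurable F) :
    ∫⁻ x : EuclideanSpace ℝ (Fin 2), F (‖x‖ ^ 2) =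
      ENNReal.ofReal Real.pi * ∫⁻ u in Ioi (0 : ℝ), F u := by
  have h1 := (PiLp.volume_preserving_ofLp (Fin 2)).lintegral_comp
    (f := fun y : Fin 2 → ℝ => F (y 0 ^ 2 + y 1 ^ 2)) (by fun_prop)
  have h2 := (volume_preserving_finTwoArrow ℝ).lintegral_comp
    (f := fun p : ℝ × ℝ => F (p.1 ^ 2 + p.2 ^ 2)) (by fun_prop)
  rw [← lintegral_prod_comp_sq_add_sq hF, ← h2]
  refine Eq.trans (lintegral_congr fun x => ?_) h1
  rw [EuclideanSpace.real_norm_sq_eq, Fin.sum_univ_two]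

instance : IsProbabilityMeasure stdComplexGaussian :=
  Measure.isProbabilityMeasure_map (Complex.measurableEquivRealProd.symm.measurable.aemeasurable)

/-- If `z` has distribution `CN(0, 1)`, then `‖z‖ ^ 2` has the exponential distribution with
mean `1`. -/
theorem lintegral_stdComplexGaussian_comp_norm_sq {F : ℝ → ℝ≥0∞} (hF : Measurable F) :
    ∫⁻ z, F (‖z‖ ^ 2) ∂stdComplexGaussian =
      ∫⁻ u in Ioi (0 : ℝ), F u * ENNReal.ofReal (Real.exp (-u)) := by
  have hv : (1 / 2 : ℝ≥0) ≠ 0 := by norm_num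
  have hmeas : Measurable fun p : ℝ × ℝ => (⟨p.1, p.2⟩ : ℂ) :=
    Complex.measurableEquivRealProd.symm.measurable
  have hpdf : ∀ p : ℝ × ℝ, gaussianPDF 0 (1 / 2) p.1 * gaussianPDF 0 (1 / 2) p.2 =
      ENNReal.ofReal (Real.pi⁻¹ * Real.exp (-(p.1 ^ 2 + p.2 ^ 2))) := by
    intro p
    rw [gaussianPDF, gaussianPDF, ← ENNReal.ofReal_mul (gaussianPDFReal_nonneg _ _ _)]
    simp only [gaussianPDFReal]
    congr 1
    have h1 : (2 * Real.pi * ((1 / 2 : ℝ≥0) : ℝ)) = Real.pi := by push_cast; ring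
    have h2 : (2 * ((1 / 2 : ℝ≥0) : ℝ)) = 1 := by push_cast; ring
    rw [h1, h2, mul_mul_mul_comm, ← mul_inv, Real.mul_self_sqrt Real.pi_pos.le, ← Real.exp_add]
    congr 2
    ring
  rw [stdComplexGaussian, lintegral_map (by fun_prop) hmeas, gaussianReal_of_var_ne_zero 0 hv,
    prod_withDensity (by fun_prop) (by fun_prop),
    lintegral_withDensity_eq_lintegral_mul _ (by fun_prop) (by fun_prop)]
  have hcongr : ∀ p : ℝ × ℝ, ((fun z : ℝ × ℝ => gaussianPDF 0 (1 / 2) z.1 *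
      gaussianPDF 0 (1 / 2) z.2) * fun p : ℝ × ℝ => F (‖(⟨p.1, p.2⟩ : ℂ)‖ ^ 2)) p =
      (fun u => ENNReal.ofReal (Real.pi⁻¹ * Real.exp (-u)) * F u) (p.1 ^ 2 + p.2 ^ 2) := by
    intro p
    simp only [Pi.mul_apply]
    rw [hpdf, Complex.sq_norm, Complex.normSq_mk, ← sq, ← sq]
  rw [lintegral_congr hcongr, ← Measure.volume_eq_prod,
    lintegral_prod_comp_sq_add_sq
      (F := fun u => ENNReal.ofReal (Real.pi⁻¹ * Real.exp (-u)) * F u) (by fun_prop),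
    ← lintegral_const_mul _ (by fun_prop)]
  refine lintegral_congr fun u => ?_
  rw [← mul_assoc, ← ENNReal.ofReal_mul Real.pi_pos.le,
    mul_inv_cancel_left₀ Real.pi_ne_zero, mul_comm]

theorem lintegral_exp_neg_mul_Ioi {b : ℝ} (hb : 0 < b) {a : ℝ} :
    ∫⁻ u in Ioi a, ENNReal.ofReal (Real.exp (-b * u)) =
      ENNReal.ofReal (Real.exp (-b * a) / b) := by
  rw [← ofReal_integral_eq_lintegral_ofReal (integrableOn_exp_mul_Ioi (by linarith) a)
    (Filter.Eventually.of_forall fun u => (Real.exp_pos _).le),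
    integral_exp_mul_Ioi (by linarith), div_neg, neg_div, neg_neg]

theorem stdComplexGaussian_le_norm_sq {a : ℝ} (ha : 0 ≤ a) :
    stdComplexGaussian {z | a ≤ ‖z‖ ^ 2} = ENNReal.ofReal (Real.exp (-a)) := by
  have hset : {z : ℂ | a ≤ ‖z‖ ^ 2} = (fun z : ℂ => ‖z‖ ^ 2) ⁻¹' Ici a := rfl
  rw [hset, ← lintegral_indicator_one (measurableSet_Ici.preimage (by fun_prop))]
  have := lintegral_stdComplexGaussian_comp_norm_sq
    (F := (Ici a).indicator 1) (measurable_one.indicator measurableSet_Ici)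
  rw [show (fun z : ℂ => ((fun z : ℂ => ‖z‖ ^ 2) ⁻¹' Ici a).indicator (1 : ℂ → ℝ≥0∞) z) =
    fun z => (Ici a).indicator 1 (‖z‖ ^ 2) from rfl, this]
  have h2 : ∀ u, (Ici a).indicator (1 : ℝ → ℝ≥0∞) u * ENNReal.ofReal (Real.exp (-u)) =
      (Ici a).indicator (fun u => ENNReal.ofReal (Real.exp (-1 * u))) u := by
    intro u
    by_cases hu : u ∈ Ici a <;> simp [hu]
  rw [lintegral_congr h2, setLIntegral_congr Ioi_ae_eq_Ici,
    setLIntegral_indicator measurableSet_Ici,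
    inter_eq_left.2 (Ici_subset_Ici.2 ha), ← setLIntegral_congr Ioi_ae_eq_Ici,
    lintegral_exp_neg_mul_Ioi one_pos]
  simp

/-- The Laplace transform of the power gain of Rayleigh fading. -/
theorem lintegral_stdComplexGaussian_expNeg {c : ℝ} (hc : 0 ≤ c) :
    ∫⁻ z, expNeg (ENNReal.ofReal (c * ‖z‖ ^ 2)) ∂stdComplexGaussian =
      expNeg (ENNReal.ofReal (Real.log (1 + c))) := by
  rw [lintegral_stdComplexGaussian_comp_norm_sq (F := fun u => expNeg (ENNReal.ofReal (c * u)))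
    (measurable_expNeg.comp (by fun_prop)), expNeg_ofReal (Real.log_nonneg (by linarith)),
    Real.exp_neg, Real.exp_log (by linarith)]
  have h : ∫⁻ u in Ioi (0 : ℝ), expNeg (ENNReal.ofReal (c * u)) * ENNReal.ofReal (Real.exp (-u)) =
      ∫⁻ u in Ioi (0 : ℝ), ENNReal.ofReal (Real.exp (-(1 + c) * u)) := by
    refine setLIntegral_congr_fun measurableSet_Ioi fun u hu => ?_
    have hu : 0 < u := hu
    rw [expNeg_ofReal (by positivity), ← ENNReal.ofReal_mul (Real.exp_pos _).le, ← Real.exp_add]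
    congr 2
    ring
  rw [h, lintegral_exp_neg_mul_Ioi (by linarith)]
  simp

/-! ### Euler's integral for `₂F₁(1, b; b + 1; ·)` -/

/-- Euler's integral `∫₀¹ b tᵇ⁻¹ / (1 - z t) dt`, which represents `₂F₁(1, b; b + 1; z)`. -/
noncomputable def eulerIntegral (b : ℝ) (z : ℂ) : ℂ :=
  ∫ t in Ioc (0 : ℝ) 1, ((b * t ^ (b - 1) : ℝ) : ℂ) * (1 - z * t)⁻¹

theorem one_sub_mul_ne_zero_of_mem_hypergeometricDomain {z : ℂ} (hz : z ∈ hypergeometricDomain)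
    {t : ℝ} (ht : t ∈ Icc (0 : ℝ) 1) : 1 - z * t ≠ 0 := by
  intro h
  have hre : z.re * t = 1 := by
    have := congrArg Complex.re h
    simp at this
    linarith
  have him : z.im * t = 0 := by
    have := congrArg Complex.im h
    simp at this
    rcases this with h | h <;> simp [h]
  have ht0 : t ≠ 0 := by
    rintro rfl
    simp at hre
  have hz' : 0 < (1 - z).re ∨ (1 - z).im ≠ 0 := hz
  rcases hz' with h1 | h1
  · simp at h1
    nlinarith [ht.1, ht.2, lt_of_le_of_ne ht.1 ht0.symm]
  · apply h1
    simpa [ht0] using him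

theorem integrableOn_mul_rpow_sub_one {b : ℝ} (hb : 0 < b) :
    IntegrableOn (fun t : ℝ => b * t ^ (b - 1)) (Ioc 0 1) := by
  refine Integrable.const_mul ?_ b
  exact (intervalIntegrable_iff_integrableOn_Ioc_of_le zero_le_one).1
    (intervalIntegral.intervalIntegrable_rpow' (by linarith))

theorem integral_mul_rpow_sub_one_mul_pow {b : ℝ} (hb : 0 < b) (n : ℕ) :
    ∫ t in Ioc (0 : ℝ) 1, b * t ^ (b - 1) * t ^ n = b / (b + n) := by
  have h : ∀ t ∈ Ioc (0 : ℝ) 1, b * t ^ (b - 1) * t ^ n = b * t ^ (b + n - 1) := by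
    intro t ht
    rw [mul_assoc, ← Real.rpow_natCast t n, ← Real.rpow_add ht.1]
    congr 2
    ring
  have hbn : 0 < b + n := by positivity
  rw [setIntegral_congr_fun measurableSet_Ioc h, integral_const_mul,
    ← intervalIntegral.integral_of_le zero_le_one, integral_rpow (Or.inl (by linarith)),
    sub_add_cancel, Real.one_rpow, Real.zero_rpow hbn.ne']
  ring

theorem analyticOnNhd_eulerIntegral {b : ℝ} (hb : 0 < b) :
    AnalyticOnNhd ℂ (eulerIntegral b) hypergeometricDomain := by
  refine DifferentiableOn.analyticOnNhd (fun z₀ hz₀ => ?_) isOpen_hypergeometricDomain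
  obtain ⟨ε, hε, hball⟩ := Metric.nhds_basis_closedBall.mem_iff.1
    (isOpen_hypergeometricDomain.mem_nhds hz₀)
  -- On the compact set `closedBall z₀ ε × [0, 1]` the denominator is bounded away from `0`.
  obtain ⟨p, hp, hmin⟩ := ((isCompact_closedBall z₀ ε).prod
    (isCompact_Icc (a := (0 : ℝ)) (b := 1))).exists_isMinOn
    (f := fun p : ℂ × ℝ => ‖1 - p.1 * p.2‖)
    ⟨(z₀, 0), Metric.mem_closedBall_self hε.le, by simp⟩ (by fun_prop)
  set δ := ‖1 - p.1 * p.2‖ with hδ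
  have hδ0 : 0 < δ := norm_pos_iff.2
    (one_sub_mul_ne_zero_of_mem_hypergeometricDomain (hball hp.1) hp.2)
  have hle : ∀ z ∈ Metric.closedBall z₀ ε, ∀ t ∈ Ioc (0 : ℝ) 1, δ ≤ ‖1 - z * t‖ :=
    fun z hz t ht => hmin (show (z, t) ∈ _ from ⟨hz, Ioc_subset_Icc_self ht⟩)
  have hmeas : ∀ z : ℂ, Measurable fun t : ℝ => ((b * t ^ (b - 1) : ℝ) : ℂ) * (1 - z * t)⁻¹ :=
    fun z => by fun_prop
  have hw : ∀ t ∈ Ioc (0 : ℝ) 1, ‖((b * t ^ (b - 1) : ℝ) : ℂ)‖ = b * t ^ (b - 1) := by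
    intro t ht
    rw [Complex.norm_real, Real.norm_of_nonneg (mul_nonneg hb.le (Real.rpow_nonneg ht.1.le _))]
  have hw0 : ∀ t ∈ Ioc (0 : ℝ) 1, 0 ≤ b * t ^ (b - 1) := fun t ht =>
    mul_nonneg hb.le (Real.rpow_nonneg ht.1.le _)
  have hint : IntegrableOn (fun t : ℝ => ((b * t ^ (b - 1) : ℝ) : ℂ) * (1 - z₀ * t)⁻¹)
      (Ioc 0 1) := by
    refine Integrable.mono' ((integrableOn_mul_rpow_sub_one hb).mul_const δ⁻¹)
      (hmeas z₀).aestronglyMeasurable ?_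
    filter_upwards [ae_restrict_mem measurableSet_Ioc] with t ht
    rw [norm_mul, hw t ht, norm_inv]
    exact mul_le_mul_of_nonneg_left
      (inv_anti₀ hδ0 (hle z₀ (Metric.mem_closedBall_self hε.le) t ht)) (hw0 t ht)
  refine (hasDerivAt_integral_of_dominated_loc_of_deriv_le
    (F' := fun z t => ((b * t ^ (b - 1) : ℝ) : ℂ) * (t / (1 - z * t) ^ 2))
    (bound := fun t => b * t ^ (b - 1) * (δ ^ 2)⁻¹)
    (Metric.closedBall_mem_nhds z₀ hε)
    (Filter.Eventually.of_forall fun z => (hmeas z).aestronglyMeasurable) hint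
    (Measurable.aestronglyMeasurable (by fun_prop)) ?_
    ((integrableOn_mul_rpow_sub_one hb).mul_const _) ?_).2.differentiableAt.differentiableWithinAt
  · filter_upwards [ae_restrict_mem measurableSet_Ioc] with t ht z hz
    rw [norm_mul, hw t ht, norm_div, norm_pow, Complex.norm_real, Real.norm_of_nonneg ht.1.le]
    refine mul_le_mul_of_nonneg_left ?_ (hw0 t ht)
    rw [← one_div]
    exact div_le_div₀ zero_le_one ht.2 (by positivity) (pow_le_pow_left₀ hδ0.le (hle z hz t ht) 2)
  · filter_upwards [ae_restrict_mem measurableSet_Ioc] with t ht z hz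
    have hne := one_sub_mul_ne_zero_of_mem_hypergeometricDomain (hball hz) (Ioc_subset_Icc_self ht)
    have h1 : HasDerivAt (fun z : ℂ => 1 - z * t) (-(t : ℂ)) z := by
      simpa using ((hasDerivAt_id z).mul_const (t : ℂ)).const_sub 1
    simpa using (h1.inv hne).const_mul ((b * t ^ (b - 1) : ℝ) : ℂ)

/-- The Gauss series of `₂F₁(1, b; b + 1; z)` has coefficients `(b)ₙ / (b + 1)ₙ = b / (b + n)`. -/
theorem hasSum_eulerIntegral {b : ℝ} (hb : 0 < b) {z : ℂ} (hz : ‖z‖ < 1) :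
    HasSum (fun n : ℕ => ((b / (b + n) : ℝ) : ℂ) * z ^ n) (eulerIntegral b z) := by
  set F : ℕ → ℝ → ℂ := fun n t => ((b * t ^ (b - 1) * t ^ n : ℝ) : ℂ) * z ^ n with hF
  have hw0 : ∀ t ∈ Ioc (0 : ℝ) 1, ∀ n : ℕ, 0 ≤ b * t ^ (b - 1) * t ^ n := fun t ht n =>
    mul_nonneg (mul_nonneg hb.le (Real.rpow_nonneg ht.1.le _)) (pow_nonneg ht.1.le n)
  have hwint : ∀ n : ℕ, IntegrableOn (fun t : ℝ => b * t ^ (b - 1) * t ^ n) (Ioc 0 1) := by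
    intro n
    refine Integrable.mono' (integrableOn_mul_rpow_sub_one hb)
      (Measurable.aestronglyMeasurable (by fun_prop)) ?_
    filter_upwards [ae_restrict_mem measurableSet_Ioc] with t ht
    rw [Real.norm_of_nonneg (hw0 t ht n)]
    exact mul_le_of_le_one_right (by simpa using hw0 t ht 0) (pow_le_one₀ ht.1.le ht.2)
  have hnorm : ∀ n : ℕ, ∫ t in Ioc (0 : ℝ) 1, ‖F n t‖ = b / (b + n) * ‖z‖ ^ n := by
    intro n
    rw [← integral_mul_rpow_sub_one_mul_pow hb n, ← integral_mul_const]
    refine setIntegral_congr_fun measurableSet_Ioc fun t ht => ?_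
    simp only [hF]
    rw [norm_mul, norm_pow, Complex.norm_real, Real.norm_of_nonneg (hw0 t ht n)]
  have hsum := hasSum_integral_of_summable_integral_norm (μ := volume.restrict (Ioc (0 : ℝ) 1))
    (F := F) (fun n => (hwint n).ofReal.mul_const _) (by
      simp_rw [hnorm]
      refine Summable.of_nonneg_of_le (fun n => by positivity) (fun n => ?_)
        (summable_geometric_of_lt_one (norm_nonneg z) hz)
      exact mul_le_of_le_one_left (by positivity)
        ((div_le_one (by positivity)).2 (le_add_of_nonneg_right n.cast_nonneg)))
  have hval : ∀ n : ℕ, ∫ t in Ioc (0 : ℝ) 1, F n t = ((b / (b + n) : ℝ) : ℂ) * z ^ n := by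
    intro n
    simp only [hF]
    rw [integral_mul_const, integral_complex_ofReal, integral_mul_rpow_sub_one_mul_pow hb n]
  have htsum : ∫ t in Ioc (0 : ℝ) 1, ∑' n, F n t = eulerIntegral b z := by
    refine setIntegral_congr_fun measurableSet_Ioc fun t ht => ?_
    have hzt : ‖z * t‖ < 1 := by
      rw [norm_mul, Complex.norm_real, Real.norm_of_nonneg ht.1.le]
      exact (mul_le_of_le_one_right (norm_nonneg z) ht.2).trans_lt hz
    refine Eq.trans (tsum_congr fun n => ?_)
      ((hasSum_geometric_of_norm_lt_one hzt).mul_left ((b * t ^ (b - 1) : ℝ) : ℂ)).tsum_eq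
    simp only [hF]
    push_cast
    rw [mul_pow]
    ring
  rw [htsum] at hsum
  simpa only [hval] using hsum

theorem isHypergeometricBranch_eulerIntegral {b : ℝ} (hb : 0 < b) :
    IsHypergeometricBranch 1 b (b + 1) (eulerIntegral b) := by
  refine ⟨analyticOnNhd_eulerIntegral hb, fun z hz => ?_⟩
  rw [ordinaryHypergeometric_eq_tsum, ← (hasSum_eulerIntegral hb (by simpa using hz)).tsum_eq]
  refine tsum_congr fun n => ?_
  have hne : ∀ k : ℕ, (b : ℂ) + k ≠ 0 := fun k => by
    have : b + k ≠ 0 := by positivity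
    exact_mod_cast this
  have hp : (ascPochhammer ℂ n).eval ((b : ℂ) + 1) ≠ 0 := by
    rw [Ne, ascPochhammer_eval_eq_zero_iff]
    rintro ⟨k, -, hk⟩
    apply hne (k + 1)
    push_cast
    rw [hk]
    ring
  have hrec : (ascPochhammer ℂ n).eval (b : ℂ) * (b + n) =
      b * (ascPochhammer ℂ n).eval ((b : ℂ) + 1) := by
    rw [← ascPochhammer_succ_eval, ascPochhammer_succ_left]
    simp
  have hfac : (n.factorial : ℂ) ≠ 0 := by exact_mod_cast n.factorial_ne_zero
  rw [ascPochhammer_eval_one, smul_eq_mul, inv_mul_cancel₀ hfac, one_mul, ← div_eq_mul_inv]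
  congr 1
  push_cast
  rw [div_eq_div_iff (hne n) hp, hrec]

/-- Euler's integral representation of `₂F₁(1, b; b + 1; x)` for real `x < 1`. -/
theorem realHyp2F1_one_eq_integral {b : ℝ} (hb : 0 < b) {x : ℝ} (hx : x < 1) :
    realHyp2F1 1 b (b + 1) x = ∫ t in Ioc (0 : ℝ) 1, b * t ^ (b - 1) * (1 - x * t)⁻¹ := by
  have hex : ∃ F, IsHypergeometricBranch ((1 : ℝ) : ℂ) b ((b + 1 : ℝ) : ℂ) F :=
    ⟨_, by simpa using isHypergeometricBranch_eulerIntegral hb⟩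
  have hmem : (x : ℂ) ∈ hypergeometricDomain := by
    refine Or.inl ?_
    simpa using hx
  have heq : hyp2F1 ((1 : ℝ) : ℂ) b ((b + 1 : ℝ) : ℂ) x = eulerIntegral b x := by
    rw [hyp2F1, dif_pos hex]
    refine hex.choose_spec.eqOn ?_ hmem
    simpa using isHypergeometricBranch_eulerIntegral hb
  rw [realHyp2F1, heq, eulerIntegral, ← Complex.ofReal_re (∫ t in Ioc (0 : ℝ) 1, _),
    ← integral_complex_ofReal]
  push_cast
  rfl

theorem realHyp2F1_one_neg_eq_integral {η : ℝ} (hη : 2 < η) {T : ℝ} (hT : 0 ≤ T) :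
    realHyp2F1 1 (1 - 2 / η) (2 - 2 / η) (-T) =
      ∫ t in Ioc (0 : ℝ) 1, (1 - 2 / η) * t ^ (-(2 / η)) * (1 + T * t)⁻¹ := by
  have hb : 0 < 1 - 2 / η := by
    rw [sub_pos, div_lt_one (by linarith)]
    exact hη
  have := realHyp2F1_one_eq_integral hb (x := -T) (by linarith)
  rw [show 1 - 2 / η + 1 = 2 - 2 / η by ring] at this
  rw [this]
  refine setIntegral_congr_fun measurableSet_Ioc fun t _ => ?_
  rw [show 1 - 2 / η - 1 = -(2 / η) by ring, show 1 - -T * t = 1 + T * t by ring]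

theorem integrableOn_mul_rpow_mul_inv {η : ℝ} (hη : 2 < η) {T : ℝ} (hT : 0 ≤ T) :
    IntegrableOn (fun t : ℝ => (1 - 2 / η) * t ^ (-(2 / η)) * (1 + T * t)⁻¹) (Ioc 0 1) := by
  have hb : 0 < 1 - 2 / η := by
    rw [sub_pos, div_lt_one (by linarith)]
    exact hη
  have h := integrableOn_mul_rpow_sub_one hb
  rw [show 1 - 2 / η - 1 = -(2 / η) by ring] at h
  refine Integrable.mono' h (Measurable.aestronglyMeasurable (by fun_prop)) ?_
  filter_upwards [ae_restrict_mem measurableSet_Ioc] with t ht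
  have h1 : 0 < 1 + T * t := add_pos_of_pos_of_nonneg one_pos (mul_nonneg hT ht.1.le)
  have h2 : 0 ≤ (1 - 2 / η) * t ^ (-(2 / η)) := mul_nonneg hb.le (Real.rpow_nonneg ht.1.le _)
  rw [Real.norm_of_nonneg (mul_nonneg h2 (inv_nonneg.2 h1.le))]
  exact mul_le_of_le_one_right h2
    (inv_le_one_of_one_le₀ (le_add_of_nonneg_right (mul_nonneg hT ht.1.le)))

theorem realHyp2F1_one_neg_le_one {η : ℝ} (hη : 2 < η) {T : ℝ} (hT : 0 ≤ T) :
    realHyp2F1 1 (1 - 2 / η) (2 - 2 / η) (-T) ≤ 1 := by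
  have hb : 0 < 1 - 2 / η := by
    rw [sub_pos, div_lt_one (by linarith)]
    exact hη
  have h0 := integral_mul_rpow_sub_one_mul_pow hb 0
  have hint := integrableOn_mul_rpow_sub_one hb
  simp only [pow_zero, mul_one, Nat.cast_zero, add_zero, div_self hb.ne'] at h0
  rw [show 1 - 2 / η - 1 = -(2 / η) by ring] at h0 hint
  rw [realHyp2F1_one_neg_eq_integral hη hT]
  refine le_trans ?_ h0.le
  refine setIntegral_mono_on (integrableOn_mul_rpow_mul_inv hη hT) hint measurableSet_Ioc
    fun t ht => ?_
  exact mul_le_of_le_one_right (mul_nonneg hb.le (Real.rpow_nonneg ht.1.le _))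
    (inv_le_one_of_one_le₀ (le_add_of_nonneg_right (mul_nonneg hT ht.1.le)))

/-- The interference exponent grows at least logarithmically, since `t ^ (-2 / η) ≥ 1` on
`(0, 1]` in Euler's integral. -/
theorem mul_log_one_add_le_mul_realHyp2F1 {η : ℝ} (hη : 2 < η) {T : ℝ} (hT : 0 ≤ T) :
    (1 - 2 / η) * Real.log (1 + T) ≤ T * realHyp2F1 1 (1 - 2 / η) (2 - 2 / η) (-T) := by
  have hb : 0 < 1 - 2 / η := by
    rw [sub_pos, div_lt_one (by linarith)]
    exact hη
  have hpos : ∀ t ∈ Icc (0 : ℝ) 1, 0 < 1 + T * t := fun t ht =>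
    add_pos_of_pos_of_nonneg one_pos (mul_nonneg hT ht.1)
  have hcont : ContinuousOn (fun t : ℝ => T * (1 + T * t)⁻¹) (Icc 0 1) :=
    ContinuousOn.mul continuousOn_const
      (ContinuousOn.inv₀ (by fun_prop) fun t ht => (hpos t ht).ne')
  have hlog : ∫ t in Ioc (0 : ℝ) 1, T * (1 + T * t)⁻¹ = Real.log (1 + T) := by
    rw [← intervalIntegral.integral_of_le zero_le_one,
      intervalIntegral.integral_eq_sub_of_hasDerivAt (f := fun t => Real.log (1 + T * t))]
    · simp
    · intro t ht
      rw [uIcc_of_le zero_le_one] at ht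
      have h1 : HasDerivAt (fun t : ℝ => 1 + T * t) T t := by
        simpa using ((hasDerivAt_id t).const_mul T).const_add 1
      simpa [div_eq_mul_inv] using h1.log (hpos t ht).ne'
    · exact (hcont.mono (by rw [uIcc_of_le zero_le_one])).intervalIntegrable
  rw [realHyp2F1_one_neg_eq_integral hη hT, ← hlog, ← integral_const_mul, ← integral_const_mul]
  refine setIntegral_mono_on ((hcont.integrableOn_compact isCompact_Icc).mono_set
    Ioc_subset_Icc_self |>.const_mul _) ((integrableOn_mul_rpow_mul_inv hη hT).const_mul _)
    measurableSet_Ioc fun t ht => ?_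
  have h1 : 1 ≤ t ^ (-(2 / η)) :=
    Real.one_le_rpow_of_pos_of_le_one_of_nonpos ht.1 ht.2 (neg_nonpos.2 (by positivity))
  have h2 : 0 ≤ (1 - 2 / η) * (T * (1 + T * t)⁻¹) :=
    mul_nonneg hb.le (mul_nonneg hT (inv_nonneg.2 (hpos t (Ioc_subset_Icc_self ht)).le))
  calc (1 - 2 / η) * (T * (1 + T * t)⁻¹) ≤ (1 - 2 / η) * (T * (1 + T * t)⁻¹) * t ^ (-(2 / η)) :=
        le_mul_of_one_le_right h2 h1
    _ = T * ((1 - 2 / η) * t ^ (-(2 / η)) * (1 + T * t)⁻¹) := by ring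

theorem realHyp2F1_one_neg_nonneg {η : ℝ} (hη : 2 < η) {T : ℝ} (hT : 0 ≤ T) :
    0 ≤ realHyp2F1 1 (1 - 2 / η) (2 - 2 / η) (-T) := by
  have hb : 0 < 1 - 2 / η := by
    rw [sub_pos, div_lt_one (by linarith)]
    exact hη
  rw [realHyp2F1_one_neg_eq_integral hη hT]
  refine setIntegral_nonneg measurableSet_Ioc fun t ht => ?_
  have := ht.1
  positivity

/-- For path-loss exponent `4` the hypergeometric function is elementary. -/
theorem mul_realHyp2F1_half_eq_arctan {T : ℝ} (hT : 0 ≤ T) :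
    T * realHyp2F1 1 (1 - 2 / 4) (2 - 2 / 4) (-T) = √T * Real.arctan √T := by
  rw [realHyp2F1_one_neg_eq_integral (by norm_num) hT, ← integral_const_mul,
    ← intervalIntegral.integral_of_le zero_le_one,
    intervalIntegral.integral_eq_sub_of_hasDerivAt_of_le zero_le_one
      (f := fun t => √T * Real.arctan (√T * √t))]
  · simp
  · exact (by fun_prop : Continuous _).continuousOn
  · intro t ht
    have h1 := (((Real.hasDerivAt_sqrt ht.1.ne').const_mul (√T)).arctan).const_mul (√T)
    refine h1.congr_deriv ?_
    rw [mul_pow, Real.sq_sqrt hT, Real.sq_sqrt ht.1.le, show (-(2 / 4) : ℝ) = -(1 / 2) by norm_num,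
      Real.rpow_neg ht.1.le, ← Real.sqrt_eq_rpow]
    have hne : √t ≠ 0 := (Real.sqrt_pos.2 ht.1).ne'
    have hne' : 1 + T * t ≠ 0 := (add_pos_of_pos_of_nonneg one_pos (mul_nonneg hT ht.1.le)).ne'
    field_simp
    rw [Real.sq_sqrt hT]
    ring
  · exact (intervalIntegrable_iff_integrableOn_Ioc_of_le zero_le_one).2
      ((integrableOn_mul_rpow_mul_inv (by norm_num) hT).const_mul T)

/-! ### The interference exponent -/

theorem one_sub_expNeg_log_one_add {c : ℝ} (hc : 0 ≤ c) :
    1 - expNeg (ENNReal.ofReal (Real.log (1 + c))) = ENNReal.ofReal (c / (1 + c)) := by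
  rw [expNeg_ofReal (Real.log_nonneg (by linarith)), Real.exp_neg, Real.exp_log (by linarith),
    ← ENNReal.ofReal_one, ← ENNReal.ofReal_sub _ (by positivity)]
  congr 1
  field_simp
  ring

/-- The radial integral in the interference exponent, in the variable `u = ‖x‖ ^ 2`. -/
theorem lintegral_Ioi_pathloss {η r₀ : ℝ} (hη : 2 < η) (hr₀ : 0 < r₀) {T : ℝ} (hT : 0 ≤ T) :
    ∫⁻ u in Ioi (r₀ ^ 2), ENNReal.ofReal
        (T * r₀ ^ η * u ^ (-(η / 2)) / (1 + T * r₀ ^ η * u ^ (-(η / 2)))) =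
      ENNReal.ofReal (2 * T * r₀ ^ 2 / (η - 2) *
        realHyp2F1 1 (1 - 2 / η) (2 - 2 / η) (-T)) := by
  have hη0 : 0 < η := by linarith
  have hb : 0 < 1 - 2 / η := by
    rw [sub_pos, div_lt_one (by linarith)]
    exact hη
  have hneg : -(2 / η) < 0 := neg_neg_of_pos (by positivity)
  -- Substitute `u = r₀² v ^ (-2 / η)`, so that the path-loss `(√u / r₀) ^ (-η)` becomes `v`.
  have himg : (fun v : ℝ => r₀ ^ 2 * v ^ (-(2 / η))) '' Ioo 0 1 = Ioi (r₀ ^ 2) := by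
    ext u
    constructor
    · rintro ⟨v, hv, rfl⟩
      exact lt_mul_of_one_lt_right (by positivity)
        (Real.one_lt_rpow_of_pos_of_lt_one_of_neg hv.1 hv.2 hneg)
    · intro hu
      have hu1 : 1 < u / r₀ ^ 2 := (one_lt_div (by positivity)).2 hu
      have hu0 : 0 < u / r₀ ^ 2 := one_pos.trans hu1
      refine ⟨(u / r₀ ^ 2) ^ (-(η / 2)), ⟨Real.rpow_pos_of_pos hu0 _,
        Real.rpow_lt_one_of_one_lt_of_neg hu1 (by linarith)⟩, ?_⟩
      simp only
      rw [← Real.rpow_mul hu0.le, show -(η / 2) * -(2 / η) = 1 by field_simp, Real.rpow_one]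
      field_simp
  have hinj : InjOn (fun v : ℝ => r₀ ^ 2 * v ^ (-(2 / η))) (Ioo 0 1) := by
    intro v hv w hw h
    have h' := mul_left_cancel₀ (pow_pos hr₀ 2).ne' h
    exact (Real.rpow_left_inj hv.1.le hw.1.le hneg.ne).1 h'
  have hderiv : ∀ v ∈ Ioo (0 : ℝ) 1, HasDerivWithinAt (fun v : ℝ => r₀ ^ 2 * v ^ (-(2 / η)))
      (r₀ ^ 2 * (-(2 / η) * v ^ (-(2 / η) - 1))) (Ioo 0 1) v := fun v hv =>
    ((Real.hasDerivAt_rpow_const (Or.inl hv.1.ne')).const_mul _).hasDerivWithinAt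
  rw [← himg, lintegral_image_eq_lintegral_abs_deriv_mul measurableSet_Ioo hderiv hinj,
    realHyp2F1_one_neg_eq_integral hη hT, ← integral_const_mul,
    ofReal_integral_eq_lintegral_ofReal ((integrableOn_mul_rpow_mul_inv hη hT).const_mul _),
    ← setLIntegral_congr Ioo_ae_eq_Ioc]
  · refine setLIntegral_congr_fun measurableSet_Ioo fun v hv => ?_
    have hv0 := hv.1
    have hT1 : 0 < 1 + T * v := add_pos_of_pos_of_nonneg one_pos (mul_nonneg hT hv0.le)
    have hc : T * r₀ ^ η * (r₀ ^ 2 * v ^ (-(2 / η))) ^ (-(η / 2)) = T * v := by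
      rw [Real.mul_rpow (by positivity) (Real.rpow_nonneg hv0.le _), ← Real.rpow_mul hv0.le,
        show -(2 / η) * -(η / 2) = 1 by field_simp, Real.rpow_one, ← Real.rpow_natCast r₀ 2,
        ← Real.rpow_mul hr₀.le, mul_assoc, ← mul_assoc (r₀ ^ η), ← Real.rpow_add hr₀]
      norm_num
      left
      rw [show η + -(2 * (η / 2)) = 0 by ring, Real.rpow_zero, one_mul]
    rw [hc, ← ENNReal.ofReal_mul (abs_nonneg _), abs_mul, abs_mul, abs_neg,
      abs_of_pos (by positivity : 0 < r₀ ^ 2), abs_of_pos (by positivity : 0 < 2 / η),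
      abs_of_pos (Real.rpow_pos_of_pos hv0 _), Real.rpow_sub_one hv0.ne']
    congr 1
    have : η - 2 ≠ 0 := by linarith
    field_simp
  · filter_upwards [ae_restrict_mem measurableSet_Ioc] with t ht
    have := ht.1
    have : 0 < η - 2 := by linarith
    simp only [Pi.zero_apply]
    positivity

/-- The exponent of the Laplace functional of the interferers: with `c = T r₀^η ‖x‖^(-η)` the
integrand `1 - exp (-log (1 + c))` is `c / (1 + c)`. -/
theorem lintegral_interferers_one_sub_expNeg {lam η r₀ : ℝ} (hlam : 0 < lam) (hη : 2 < η)
    (hr₀ : 0 < r₀) {T : ℝ} (hT : 0 ≤ T) :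
    ∫⁻ x, (1 - expNeg (ENNReal.ofReal (Real.log (1 + T * r₀ ^ η * ‖x‖ ^ (-η)))))
      ∂(ENNReal.ofReal lam • (volume : Measure (EuclideanSpace ℝ (Fin 2))).restrict
        {x | r₀ < ‖x‖}) =
      ENNReal.ofReal (2 * Real.pi * lam * T * r₀ ^ 2 / (η - 2) *
        realHyp2F1 1 (1 - 2 / η) (2 - 2 / η) (-T)) := by
  set F : ℝ → ℝ≥0∞ := (Ioi (r₀ ^ 2)).indicator fun u => ENNReal.ofReal
    (T * r₀ ^ η * u ^ (-(η / 2)) / (1 + T * r₀ ^ η * u ^ (-(η / 2)))) with hF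
  have hFm : Measurable F := Measurable.indicator (by fun_prop) measurableSet_Ioi
  have hS : MeasurableSet {x : EuclideanSpace ℝ (Fin 2) | r₀ < ‖x‖} :=
    measurableSet_lt measurable_const measurable_norm
  have hx : ∀ x : EuclideanSpace ℝ (Fin 2), {x | r₀ < ‖x‖}.indicator (fun x =>
      1 - expNeg (ENNReal.ofReal (Real.log (1 + T * r₀ ^ η * ‖x‖ ^ (-η))))) x = F (‖x‖ ^ 2) := by
    intro x
    have hiff : x ∈ {x : EuclideanSpace ℝ (Fin 2) | r₀ < ‖x‖} ↔ ‖x‖ ^ 2 ∈ Ioi (r₀ ^ 2) :=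
      (pow_lt_pow_iff_left₀ hr₀.le (norm_nonneg x) two_ne_zero).symm
    have hp : (‖x‖ ^ 2) ^ (-(η / 2)) = ‖x‖ ^ (-η) := by
      rw [← Real.rpow_natCast ‖x‖ 2, ← Real.rpow_mul (norm_nonneg x)]
      congr 1
      push_cast
      ring
    by_cases h : x ∈ {x : EuclideanSpace ℝ (Fin 2) | r₀ < ‖x‖}
    · rw [indicator_of_mem h, hF, indicator_of_mem (hiff.1 h), hp,
        one_sub_expNeg_log_one_add (by positivity)]
    · rw [indicator_of_notMem h, hF, indicator_of_notMem fun h' => h (hiff.2 h')]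
  rw [lintegral_smul_measure, ← lintegral_indicator hS, lintegral_congr hx,
    lintegral_euclidean_comp_norm_sq hFm, hF, setLIntegral_indicator measurableSet_Ioi,
    inter_eq_left.2 (Ioi_subset_Ioi (by positivity)), lintegral_Ioi_pathloss hη hr₀ hT, smul_eq_mul,
    ← ENNReal.ofReal_mul Real.pi_pos.le, ← ENNReal.ofReal_mul hlam.le]
  congr 1
  ring

/-! ### Exceedance probabilities -/

/-- The tail of the power gain of Rayleigh fading, for thresholds in `[0, ∞]`. -/
theorem measure_le_norm_sq_of_map_eq {Ω : Type*} [MeasurableSpace Ω]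
    {μ : Measure Ω} {g : Ω → ℂ} (hg : Measurable g)
    (hlaw : μ.map g = stdComplexGaussian) (w : ℝ≥0∞) :
    μ {ω | w ≤ ENNReal.ofReal (‖g ω‖ ^ 2)} = expNeg w := by
  induction w with
  | top => simp
  | coe a =>
    have hset : {ω | (a : ℝ≥0∞) ≤ ENNReal.ofReal (‖g ω‖ ^ 2)} =
        g ⁻¹' {z | (a : ℝ) ≤ ‖z‖ ^ 2} := by
      ext ω
      simp only [mem_ofPred_eq, mem_preimage]
      rw [← ENNReal.ofReal_coe_nnreal, ENNReal.ofReal_le_ofReal_iff (by positivity)]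
    rw [hset, ← Measure.map_apply hg (measurableSet_le measurable_const (by fun_prop)), hlaw,
      stdComplexGaussian_le_norm_sq a.coe_nonneg, ← expNeg_ofReal a.coe_nonneg,
      ENNReal.ofReal_coe_nnreal]

section Exceedance

variable {Ω : Type*} [MeasurableSpace Ω] {μ : Measure Ω} [IsProbabilityMeasure μ]

/-- If `Y` is exponentially distributed with mean `1` and independent of `W`, then
`ℙ(W ≤ Y) = 𝔼[exp (-W)]`. -/
theorem measure_le_eq_lintegral_expNeg {W Y : Ω → ℝ≥0∞} (hW : Measurable W) (hY : Measurable Y)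
    (hindep : IndepFun W Y μ) (hlaw : ∀ w, μ {ω | w ≤ Y ω} = expNeg w) :
    μ {ω | W ω ≤ Y ω} = ∫⁻ ω, expNeg (W ω) ∂μ := by
  have hS : MeasurableSet {p : ℝ≥0∞ × ℝ≥0∞ | p.1 ≤ p.2} :=
    measurableSet_le measurable_fst measurable_snd
  have h1 : μ {ω | W ω ≤ Y ω} =
      (μ.map fun ω => (W ω, Y ω)) {p : ℝ≥0∞ × ℝ≥0∞ | p.1 ≤ p.2} := by
    rw [Measure.map_apply (hW.prodMk hY) hS]
    rfl
  rw [h1, (indepFun_iff_map_prod_eq_prod_map_map hW.aemeasurable hY.aemeasurable).1 hindep,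
    Measure.prod_apply hS, lintegral_map (measurable_measure_prodMk_left hS) hW]
  refine lintegral_congr fun ω => ?_
  rw [Measure.map_apply hY (measurable_prodMk_left hS)]
  exact hlaw (W ω)

/-- The event `{ω | p (X ω) (H ω)}` for independent `X` and `H`, by conditioning on `X`. -/
theorem ProbabilityTheory.IndepFun.measure_eq_lintegral_measure {α β : Type*} [MeasurableSpace α]
    [MeasurableSpace β] {X : Ω → α} {H : Ω → β} (hX : Measurable X) (hH : Measurable H)
    (hindep : IndepFun X H μ) {S : Set (α × β)} (hS : MeasurableSet S) :
    μ {ω | (X ω, H ω) ∈ S} = ∫⁻ ω, μ {ω' | (X ω, H ω') ∈ S} ∂μ := by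
  have h1 : μ {ω | (X ω, H ω) ∈ S} = (μ.map fun ω => (X ω, H ω)) S := by
    rw [Measure.map_apply (hX.prodMk hH) hS]
    rfl
  rw [h1, (indepFun_iff_map_prod_eq_prod_map_map hX.aemeasurable hH.aemeasurable).1 hindep,
    Measure.prod_apply hS, lintegral_map (measurable_measure_prodMk_left hS) hX]
  refine lintegral_congr fun ω => ?_
  rw [Measure.map_apply hH (measurable_prodMk_left hS)]
  rfl

/-- Exceedance probability over finitely many interferers with fixed path-losses `c k`. -/
theorem measure_add_sum_le_norm_sq {h : ℕ → Ω → ℂ} (hm : ∀ k, Measurable (h k))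
    (hlaw : ∀ k, μ.map (h k) = stdComplexGaussian) (hindep : iIndepFun h μ) (a : ℝ≥0∞)
    {c : ℕ → ℝ} (hc : ∀ k, 0 ≤ c k) (n : ℕ) :
    μ {ω | a + ∑ k ∈ Finset.range n, ENNReal.ofReal (c k * ‖h (k + 1) ω‖ ^ 2) ≤
        ENNReal.ofReal (‖h 0 ω‖ ^ 2)} =
      expNeg (a + ∑ k ∈ Finset.range n, ENNReal.ofReal (Real.log (1 + c k))) := by
  -- The serving station gets weight `1`, interferer `k + 1` gets weight `c k`.
  obtain ⟨d, hd0, hd1⟩ : ∃ d : ℕ → ℝ, d 0 = 1 ∧ ∀ k, d (k + 1) = c k :=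
    ⟨fun k => Nat.casesOn k 1 c, rfl, fun _ => rfl⟩
  obtain ⟨f, hf⟩ : ∃ f : ℕ → Ω → ℝ≥0∞, ∀ k, f k = fun ω => ENNReal.ofReal (d k * ‖h k ω‖ ^ 2) :=
    ⟨_, fun _ => rfl⟩
  have hfm : ∀ k, Measurable (f k) := fun k => by
    rw [hf]
    have := hm k
    fun_prop
  have hfi : iIndepFun f μ := by
    rw [funext hf]
    exact hindep.comp (fun k z => ENNReal.ofReal (d k * ‖z‖ ^ 2)) fun k => by fun_prop
  have hsum : (fun ω => a + ∑ k ∈ Finset.range n, ENNReal.ofReal (c k * ‖h (k + 1) ω‖ ^ 2)) =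
      (fun x => a + x) ∘ (∑ j ∈ (Finset.range n).map ⟨Nat.succ, Nat.succ_injective⟩, f j) := by
    funext ω
    rw [Function.comp_apply, Finset.sum_apply, Finset.sum_map]
    congr 1
    exact Finset.sum_congr rfl fun k _ => by simp [hf, hd1]
  have h0 : (fun ω => ENNReal.ofReal (‖h 0 ω‖ ^ 2)) = f 0 := by simp [hf, hd0]
  have hmem : 0 ∉ (Finset.range n).map ⟨Nat.succ, Nat.succ_injective⟩ := by simp
  have hind : IndepFun (fun ω => a +
      ∑ k ∈ Finset.range n, ENNReal.ofReal (c k * ‖h (k + 1) ω‖ ^ 2))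
      (fun ω => ENNReal.ofReal (‖h 0 ω‖ ^ 2)) μ := by
    rw [hsum, h0]
    exact (hfi.indepFun_finsetSum_of_notMem hfm hmem).comp (measurable_const_add a) measurable_id
  have hgi : iIndepFun (fun k ω => expNeg (ENNReal.ofReal (c k * ‖h (k + 1) ω‖ ^ 2))) μ :=
    (hindep.precomp Nat.succ_injective).comp
      (fun k z => expNeg (ENNReal.ofReal (c k * ‖z‖ ^ 2))) fun k =>
        measurable_expNeg.comp (by fun_prop)
  have hgm : ∀ k, Measurable fun ω => expNeg (ENNReal.ofReal (c k * ‖h (k + 1) ω‖ ^ 2)) :=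
    fun k => measurable_expNeg.comp (by have := hm (k + 1); fun_prop)
  have hWm : Measurable fun ω => a +
      ∑ k ∈ Finset.range n, ENNReal.ofReal (c k * ‖h (k + 1) ω‖ ^ 2) :=
    measurable_const.add (Finset.measurable_sum _ fun k _ => by have := hm (k + 1); fun_prop)
  rw [measure_le_eq_lintegral_expNeg hWm (by have := hm 0; fun_prop) hind
    (measure_le_norm_sq_of_map_eq (hm 0) (hlaw 0))]
  simp_rw [expNeg_add, expNeg_sum]
  rw [lintegral_const_mul _ (Finset.measurable_prod _ fun k _ => hgm k),
    lintegral_prod_eq_prod_lintegral_of_indepFun _ _ hgi hgm]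
  congr 1
  refine Finset.prod_congr rfl fun k _ => ?_
  rw [← lintegral_stdComplexGaussian_expNeg (hc k), ← hlaw (k + 1),
    lintegral_map (f := fun z => expNeg (ENNReal.ofReal (c k * ‖z‖ ^ 2)))
      (measurable_expNeg.comp (by fun_prop)) (hm _)]

/-- Exceedance probability over all interferers with fixed path-losses `c k`. -/
theorem measure_add_tsum_le_norm_sq {h : ℕ → Ω → ℂ} (hm : ∀ k, Measurable (h k))
    (hlaw : ∀ k, μ.map (h k) = stdComplexGaussian) (hindep : iIndepFun h μ) (a : ℝ≥0∞)
    {c : ℕ → ℝ} (hc : ∀ k, 0 ≤ c k) :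
    μ {ω | a + ∑' k, ENNReal.ofReal (c k * ‖h (k + 1) ω‖ ^ 2) ≤ ENNReal.ofReal (‖h 0 ω‖ ^ 2)} =
      expNeg (a + ∑' k, ENNReal.ofReal (Real.log (1 + c k))) := by
  set s : ℕ → Set Ω := fun n => {ω | a + ∑ k ∈ Finset.range n,
    ENNReal.ofReal (c k * ‖h (k + 1) ω‖ ^ 2) ≤ ENNReal.ofReal (‖h 0 ω‖ ^ 2)} with hs
  have hlim : ∀ u : ℕ → ℝ≥0∞, Filter.Tendsto (fun n => a + ∑ k ∈ Finset.range n, u k)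
      Filter.atTop (𝓝 (a + ∑' k, u k)) := fun u =>
    tendsto_const_nhds.add (ENNReal.tendsto_nat_tsum u)
  have hset : {ω | a + ∑' k, ENNReal.ofReal (c k * ‖h (k + 1) ω‖ ^ 2) ≤
      ENNReal.ofReal (‖h 0 ω‖ ^ 2)} = ⋂ n, s n := by
    ext ω
    simp only [mem_iInter, hs, mem_ofPred_eq]
    exact ⟨fun hω n => (add_le_add_right (ENNReal.sum_le_tsum _) a).trans hω,
      fun hω => le_of_tendsto' (hlim _) hω⟩
  have hanti : Antitone s := by
    intro m n hmn ω hω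
    refine le_trans (add_le_add_right ?_ a) hω
    exact Finset.sum_le_sum_of_subset (Finset.range_mono hmn)
  have hsm : ∀ n, MeasurableSet (s n) := fun n =>
    measurableSet_le
      (measurable_const.add (Finset.measurable_sum _ fun k _ => by have := hm (k + 1); fun_prop))
      (by have := hm 0; fun_prop)
  have h1 := tendsto_measure_iInter_atTop (μ := μ) (fun n => (hsm n).nullMeasurableSet) hanti
    ⟨0, measure_ne_top _ _⟩
  rw [hset]
  refine tendsto_nhds_unique h1 ?_
  refine ((continuous_expNeg.tendsto _).comp (hlim _)).congr fun n => ?_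
  exact (measure_add_sum_le_norm_sq hm hlaw hindep a hc n).symm

end Exceedance

/-! ### The interference of the downlink network -/

theorem IsDownlinkNetwork.measurable_location {Ω : Type*} [MeasurableSpace Ω]
    {μ : Measure Ω} {lam r₀ : ℝ} {X : ℕ → Ω → EuclideanSpace ℝ (Fin 2)} {h : ℕ → Ω → ℂ}
    (hnet : IsDownlinkNetwork μ lam r₀ X h) (k : ℕ) :
    Measurable (X k) := by
  cases k with
  | zero => exact hnet.measurable_serving
  | succ k => exact hnet.interferers.measurable k

/-- The interference as an element of `[0, ∞]`, in units of the transmit power. -/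
noncomputable def normalizedInterference {Ω : Type*} (η : ℝ) (X : ℕ → Ω → EuclideanSpace ℝ (Fin 2))
    (h : ℕ → Ω → ℂ) (ω : Ω) : ℝ≥0∞ :=
  ∑' k, ENNReal.ofReal (‖X (k + 1) ω‖ ^ (-η) * ‖h (k + 1) ω‖ ^ 2)

section Network

variable {Ω : Type*} [MeasurableSpace Ω] {μ : Measure Ω} [IsProbabilityMeasure μ]
  {lam r₀ : ℝ} {X : ℕ → Ω → EuclideanSpace ℝ (Fin 2)} {h : ℕ → Ω → ℂ}

/-- The probability that the fading of the serving station exceeds `a` plus a multiple of the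
interference. -/
theorem IsDownlinkNetwork.measure_add_mul_normalizedInterference_le
    (hnet : IsDownlinkNetwork μ lam r₀ X h) (hlam : 0 < lam) (hr₀ : 0 < r₀) {η : ℝ} (hη : 2 < η)
    (a : ℝ≥0∞) {T : ℝ} (hT : 0 ≤ T) :
    μ {ω | a + ENNReal.ofReal (T * r₀ ^ η) * normalizedInterference η X h ω ≤
        ENNReal.ofReal (‖h 0 ω‖ ^ 2)} =
      expNeg (a + ENNReal.ofReal (2 * Real.pi * lam * T * r₀ ^ 2 / (η - 2) *
        realHyp2F1 1 (1 - 2 / η) (2 - 2 / η) (-T))) := by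
  have hX := hnet.measurable_location
  have hh := hnet.measurable_fading
  have hTr : 0 ≤ T * r₀ ^ η := by positivity
  set S : Set ((ℕ → EuclideanSpace ℝ (Fin 2)) × (ℕ → ℂ)) := {p | a + ∑' k, ENNReal.ofReal
    (T * r₀ ^ η * ‖p.1 (k + 1)‖ ^ (-η) * ‖p.2 (k + 1)‖ ^ 2) ≤ ENNReal.ofReal (‖p.2 0‖ ^ 2)} with hS
  have hSm : MeasurableSet S :=
    measurableSet_le (measurable_const.add (Measurable.tsum fun k => by fun_prop)) (by fun_prop)
  have hset : {ω | a + ENNReal.ofReal (T * r₀ ^ η) * normalizedInterference η X h ω ≤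
      ENNReal.ofReal (‖h 0 ω‖ ^ 2)} = {ω | ((fun k => X k ω), (fun k => h k ω)) ∈ S} := by
    ext ω
    simp only [hS, mem_ofPred_eq, normalizedInterference]
    rw [← ENNReal.tsum_mul_left]
    simp_rw [← ENNReal.ofReal_mul hTr, mul_assoc]
  rw [hset, hnet.indep_locations.measure_eq_lintegral_measure (measurable_pi_lambda _ hX)
    (measurable_pi_lambda _ hh) hSm]
  have hslice : ∀ ω, μ {ω' | ((fun k => X k ω), (fun k => h k ω')) ∈ S} = expNeg a *
      expNeg (∑' k, ENNReal.ofReal (Real.log (1 + T * r₀ ^ η * ‖X (k + 1) ω‖ ^ (-η)))) := by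
    intro ω
    rw [← expNeg_add]
    exact measure_add_tsum_le_norm_sq hh hnet.rayleigh hnet.indep_fading a
      (fun k => mul_nonneg hTr (Real.rpow_nonneg (norm_nonneg _) _))
  have hσ : SigmaFinite (ENNReal.ofReal lam •
      (volume : Measure (EuclideanSpace ℝ (Fin 2))).restrict {x | r₀ < ‖x‖}) :=
    inferInstanceAs (SigmaFinite (Real.toNNReal lam •
      (volume : Measure (EuclideanSpace ℝ (Fin 2))).restrict {x | r₀ < ‖x‖}))
  have hfm : Measurable fun x : EuclideanSpace ℝ (Fin 2) =>
      ENNReal.ofReal (Real.log (1 + T * r₀ ^ η * ‖x‖ ^ (-η))) := by fun_prop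
  have hgm : Measurable fun ω => expNeg (∑' k, ENNReal.ofReal
      (Real.log (1 + T * r₀ ^ η * ‖X (k + 1) ω‖ ^ (-η)))) :=
    measurable_expNeg.comp (Measurable.tsum fun k => hfm.comp (hX (k + 1)))
  rw [lintegral_congr hslice, lintegral_const_mul _ hgm,
    hnet.interferers.lintegral_expNeg_tsum hfm,
    lintegral_interferers_one_sub_expNeg hlam hη hr₀ hT, expNeg_add]

/-- The interference is almost surely finite: the probability that it is finite is at least the
probability of a signal-to-interference ratio above `T`, which tends to `1` as `T → 0`. -/
theorem IsDownlinkNetwork.ae_normalizedInterference_ne_top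
    (hnet : IsDownlinkNetwork μ lam r₀ X h) (hlam : 0 < lam) (hr₀ : 0 < r₀) {η : ℝ}
    (hη : 2 < η) : ∀ᵐ ω ∂μ, normalizedInterference η X h ω ≠ ⊤ := by
  have hm : Measurable (normalizedInterference η X h) := Measurable.tsum fun k => by
    have := hnet.measurable_location (k + 1)
    have := hnet.measurable_fading (k + 1)
    fun_prop
  have hms : MeasurableSet {ω | normalizedInterference η X h ω ≠ ⊤} :=
    (hm (measurableSet_singleton ⊤)).compl
  rw [ae_iff_prob_eq_one (measurableSet_setOfPred.1 hms)]
  refine le_antisymm prob_le_one ?_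
  set C : ℝ := 2 * Real.pi * lam * r₀ ^ 2 / (η - 2) with hC
  have hC0 : 0 ≤ C := by
    have : 0 < η - 2 := by linarith
    positivity
  have hle : ∀ T : ℝ, 0 < T → expNeg (ENNReal.ofReal (C * T)) ≤
      μ {ω | normalizedInterference η X h ω ≠ ⊤} := by
    intro T hT
    have h1 := hnet.measure_add_mul_normalizedInterference_le hlam hr₀ hη 0 hT.le
    calc expNeg (ENNReal.ofReal (C * T)) ≤ expNeg (0 + ENNReal.ofReal
          (2 * Real.pi * lam * T * r₀ ^ 2 / (η - 2) *
            realHyp2F1 1 (1 - 2 / η) (2 - 2 / η) (-T))) := by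
          rw [zero_add]
          refine expNeg_antitone (ENNReal.ofReal_le_ofReal ?_)
          have h2 : 2 * Real.pi * lam * T * r₀ ^ 2 / (η - 2) = C * T := by rw [hC]; ring
          rw [h2]
          exact mul_le_of_le_one_right (mul_nonneg hC0 hT.le) (realHyp2F1_one_neg_le_one hη hT.le)
      _ ≤ _ := by
          rw [← h1]
          refine measure_mono fun ω hω htop => ?_
          have hpos : ENNReal.ofReal (T * r₀ ^ η) ≠ 0 := by
            rw [Ne, ENNReal.ofReal_eq_zero, not_le]
            positivity
          rw [mem_ofPred_eq, htop, ENNReal.mul_top hpos, add_top, top_le_iff] at hω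
          exact ENNReal.ofReal_ne_top hω
  have hlim : Filter.Tendsto (fun T => expNeg (ENNReal.ofReal (C * T))) (𝓝[>] 0) (𝓝 1) := by
    have hc : Continuous fun T => expNeg (ENNReal.ofReal (C * T)) :=
      continuous_expNeg.comp (ENNReal.continuous_ofReal.comp (by fun_prop))
    simpa using (hc.tendsto 0).mono_left nhdsWithin_le_nhds
  exact le_of_tendsto hlim (by filter_upwards [self_mem_nhdsWithin] with T hT using hle T hT)

/-- The interference is almost surely positive: the probability that it vanishes is at most the
probability of a signal-to-interference ratio above `T`, which tends to `0` as `T → ∞`. -/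
theorem IsDownlinkNetwork.ae_normalizedInterference_ne_zero
    (hnet : IsDownlinkNetwork μ lam r₀ X h) (hlam : 0 < lam) (hr₀ : 0 < r₀) {η : ℝ}
    (hη : 2 < η) : ∀ᵐ ω ∂μ, normalizedInterference η X h ω ≠ 0 := by
  have hη2 : 0 < η - 2 := by linarith
  have hη0 : 0 < η := by linarith
  set C : ℝ := 2 * Real.pi * lam * r₀ ^ 2 / (η - 2) * (1 - 2 / η) with hC
  have hC0 : 0 < C := by
    have : 0 < 1 - 2 / η := by
      rw [sub_pos, div_lt_one hη0]
      exact hη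
    positivity
  have hle : ∀ T : ℝ, 0 < T → μ {ω | ¬ normalizedInterference η X h ω ≠ 0} ≤
      expNeg (ENNReal.ofReal (C * Real.log (1 + T))) := by
    intro T hT
    have h1 := hnet.measure_add_mul_normalizedInterference_le hlam hr₀ hη 0 hT.le
    rw [zero_add] at h1
    calc μ {ω | ¬ normalizedInterference η X h ω ≠ 0} ≤ _ := measure_mono fun ω hω => by
          have hω : normalizedInterference η X h ω = 0 := not_not.1 hω
          show 0 + ENNReal.ofReal (T * r₀ ^ η) * normalizedInterference η X h ω ≤
            ENNReal.ofReal (‖h 0 ω‖ ^ 2)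
          simp [hω]
      _ = _ := h1
      _ ≤ _ := by
          refine expNeg_antitone (ENNReal.ofReal_le_ofReal ?_)
          have h2 := mul_le_mul_of_nonneg_left (mul_log_one_add_le_mul_realHyp2F1 hη hT.le)
            (by positivity : 0 ≤ 2 * Real.pi * lam * r₀ ^ 2 / (η - 2))
          rw [hC]
          calc _ = _ := by ring
            _ ≤ _ := h2
            _ = _ := by ring
  have hlim : Filter.Tendsto (fun T => expNeg (ENNReal.ofReal (C * Real.log (1 + T))))
      Filter.atTop (𝓝 0) := by
    rw [← expNeg_top]
    refine (continuous_expNeg.tendsto _).comp (ENNReal.tendsto_ofReal_atTop.comp ?_)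
    exact (Real.tendsto_log_atTop.comp
      (Filter.tendsto_atTop_add_const_left _ 1 Filter.tendsto_id)).const_mul_atTop hC0
  refine le_antisymm (ge_of_tendsto hlim ?_) zero_le
  filter_upwards [Filter.eventually_gt_atTop 0] with T hT using hle T hT

end Network

/-! ### Coverage probability and ergodic rate -/

theorem receivedPower_eq_toReal {Ω : Type*} (P η : ℝ) (X : ℕ → Ω → EuclideanSpace ℝ (Fin 2))
    (h : ℕ → Ω → ℂ) (k : ℕ) (ω : Ω) :
    receivedPower P η X h k ω =
      P * (ENNReal.ofReal (‖X k ω‖ ^ (-η) * ‖h k ω‖ ^ 2)).toReal := by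
  rw [ENNReal.toReal_ofReal (by positivity), receivedPower]
  ring

theorem summable_receivedPower {Ω : Type*} (P : ℝ) {η : ℝ}
    {X : ℕ → Ω → EuclideanSpace ℝ (Fin 2)} {h : ℕ → Ω → ℂ} {ω : Ω}
    (hZ : normalizedInterference η X h ω ≠ ⊤) :
    Summable fun k : ℕ => receivedPower P η X h (k + 1) ω := by
  simp_rw [receivedPower_eq_toReal]
  exact (ENNReal.summable_toReal hZ).mul_left P

theorem interference_eq_mul_toReal {Ω : Type*} (P η : ℝ)
    (X : ℕ → Ω → EuclideanSpace ℝ (Fin 2)) (h : ℕ → Ω → ℂ) (ω : Ω) :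
    interference P η X h ω = P * (normalizedInterference η X h ω).toReal := by
  rw [interference, normalizedInterference,
    ENNReal.tsum_toReal_eq fun _ => ENNReal.ofReal_ne_top, ← tsum_mul_left]
  exact tsum_congr fun k => receivedPower_eq_toReal P η X h (k + 1) ω

theorem sinr_nonneg {Ω : Type*} {P N₀ : ℝ} (hP : 0 < P) (hN₀ : 0 ≤ N₀) (η : ℝ)
    (X : ℕ → Ω → EuclideanSpace ℝ (Fin 2)) (h : ℕ → Ω → ℂ) (ω : Ω) :
    0 ≤ sinr P N₀ η X h ω := by
  rw [sinr, interference_eq_mul_toReal, receivedPower_eq_toReal]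
  positivity

theorem IsDownlinkNetwork.measurable_sinr {Ω : Type*} [MeasurableSpace Ω] {μ : Measure Ω}
    {lam r₀ : ℝ} {X : ℕ → Ω → EuclideanSpace ℝ (Fin 2)} {h : ℕ → Ω → ℂ}
    (hnet : IsDownlinkNetwork μ lam r₀ X h) (P N₀ η : ℝ) : Measurable (sinr P N₀ η X h) := by
  have hr : ∀ k, Measurable (receivedPower P η X h k) := fun k => by
    have := hnet.measurable_location k
    have := hnet.measurable_fading k
    unfold receivedPower
    fun_prop
  exact (hr 0).div ((Measurable.tsum fun k => hr (k + 1)).add_const N₀)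

section Network

variable {Ω : Type*} [MeasurableSpace Ω] {μ : Measure Ω} [IsProbabilityMeasure μ]
  {lam r₀ P N₀ η : ℝ} {X : ℕ → Ω → EuclideanSpace ℝ (Fin 2)} {h : ℕ → Ω → ℂ}

/-- The coverage probability `ℙ(Υ ≥ T)`. Almost surely the interference is finite and positive, so
that `T ≤ Υ` can be cleared of denominators. -/
theorem IsDownlinkNetwork.measure_le_sinr (hnet : IsDownlinkNetwork μ lam r₀ X h)
    (hlam : 0 < lam) (hr₀ : 0 < r₀) (hP : 0 < P) (hN₀ : 0 ≤ N₀) (hη : 2 < η) {T : ℝ}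
    (hT : 0 ≤ T) :
    μ {ω | T ≤ sinr P N₀ η X h ω} = ENNReal.ofReal (Real.exp (-(T * N₀ * r₀ ^ η / P) -
      2 * Real.pi * lam * T * r₀ ^ 2 / (η - 2) *
        realHyp2F1 1 (1 - 2 / η) (2 - 2 / η) (-T))) := by
  have hη2 : 0 < η - 2 := by linarith
  have ha : 0 ≤ T * N₀ * r₀ ^ η / P := by positivity
  have hK : 0 ≤ 2 * Real.pi * lam * T * r₀ ^ 2 / (η - 2) *
      realHyp2F1 1 (1 - 2 / η) (2 - 2 / η) (-T) :=
    mul_nonneg (by positivity) (realHyp2F1_one_neg_nonneg hη hT)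
  rw [← neg_add', ← expNeg_ofReal (add_nonneg ha hK), ENNReal.ofReal_add ha hK,
    ← hnet.measure_add_mul_normalizedInterference_le hlam hr₀ hη _ hT]
  refine measure_congr ?_
  filter_upwards [hnet.serving_distance, hnet.ae_normalizedInterference_ne_top hlam hr₀ hη,
    hnet.ae_normalizedInterference_ne_zero hlam hr₀ hη] with ω h0 htop hzero
  refine propext ?_
  set Z := (normalizedInterference η X h ω).toReal with hZ
  have hZ0 : 0 < Z := ENNReal.toReal_pos hzero htop
  have hrη : 0 < r₀ ^ η := Real.rpow_pos_of_pos hr₀ η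
  change T ≤ sinr P N₀ η X h ω ↔ ENNReal.ofReal (T * N₀ * r₀ ^ η / P) +
    ENNReal.ofReal (T * r₀ ^ η) * normalizedInterference η X h ω ≤ ENNReal.ofReal (‖h 0 ω‖ ^ 2)
  rw [← ENNReal.ofReal_toReal htop, ← hZ, ← ENNReal.ofReal_mul (by positivity),
    ← ENNReal.ofReal_add ha (by positivity), ENNReal.ofReal_le_ofReal_iff (by positivity), sinr,
    interference_eq_mul_toReal, ← hZ, le_div_iff₀ (by positivity), receivedPower, h0,
    Real.rpow_neg hr₀.le, ← div_eq_mul_inv, le_div_iff₀ hrη]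
  have : T * (P * Z + N₀) * r₀ ^ η = P * (T * N₀ * r₀ ^ η / P + T * r₀ ^ η * Z) := by
    field_simp
    ring
  rw [this, mul_le_mul_iff_right₀ hP]

theorem IsDownlinkNetwork.outageProbability_eq (hnet : IsDownlinkNetwork μ lam r₀ X h)
    (hlam : 0 < lam) (hr₀ : 0 < r₀) (hP : 0 < P) (hN₀ : 0 ≤ N₀) (hη : 2 < η) {T : ℝ}
    (hT : 0 ≤ T) :
    outageProbability μ P N₀ η X h T =
      1 - Real.exp (-(T * N₀ * r₀ ^ η / P) - 2 * Real.pi * lam * T * r₀ ^ 2 / (η - 2) *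
        realHyp2F1 1 (1 - 2 / η) (2 - 2 / η) (-T)) := by
  have hset : {ω | sinr P N₀ η X h ω < T} = {ω | T ≤ sinr P N₀ η X h ω}ᶜ := by
    ext ω
    simp
  rw [outageProbability, hset, probReal_compl_eq_one_sub
    (measurableSet_le measurable_const (hnet.measurable_sinr P N₀ η)), measureReal_def,
    hnet.measure_le_sinr hlam hr₀ hP hN₀ hη hT, ENNReal.toReal_ofReal (Real.exp_pos _).le]

/-- The rate integral converges: the coverage probability decays at least like a negative power
of `1 + t`. -/
theorem IsDownlinkNetwork.integrableOn_coverage_div (hnet : IsDownlinkNetwork μ lam r₀ X h)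
    (hlam : 0 < lam) (hr₀ : 0 < r₀) (hP : 0 < P) (hN₀ : 0 ≤ N₀) (hη : 2 < η) :
    IntegrableOn (fun t : ℝ => Real.exp (-(t * N₀ * r₀ ^ η / P) -
      2 * Real.pi * lam * t * r₀ ^ 2 / (η - 2) *
        realHyp2F1 1 (1 - 2 / η) (2 - 2 / η) (-t)) / (t + 1)) (Ioi 0) := by
  have hη2 : 0 < η - 2 := by linarith
  have hη0 : 0 < η := by linarith
  have hb : 0 < 1 - 2 / η := by
    rw [sub_pos, div_lt_one hη0]
    exact hη
  set A : ℝ := 2 * Real.pi * lam * r₀ ^ 2 / (η - 2) * (1 - 2 / η) with hA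
  have hA0 : 0 < A := by positivity
  have hanti : Antitone fun t => μ.real {ω | t ≤ sinr P N₀ η X h ω} := fun s t hst =>
    measureReal_mono fun ω hω => hst.trans hω
  -- Measurability comes from monotonicity of the coverage probability in the threshold.
  have hmeas : AEStronglyMeasurable (fun t : ℝ => Real.exp (-(t * N₀ * r₀ ^ η / P) -
      2 * Real.pi * lam * t * r₀ ^ 2 / (η - 2) *
        realHyp2F1 1 (1 - 2 / η) (2 - 2 / η) (-t)) / (t + 1)) (volume.restrict (Ioi 0)) := by
    refine (hanti.measurable.div (measurable_id.add_const 1)).aestronglyMeasurable.congr ?_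
    filter_upwards [ae_restrict_mem measurableSet_Ioi] with t ht
    simp only [Pi.div_apply, id, measureReal_def]
    rw [hnet.measure_le_sinr hlam hr₀ hP hN₀ hη (le_of_lt ht),
      ENNReal.toReal_ofReal (Real.exp_pos _).le]
  refine Integrable.mono' (integrableOn_add_rpow_Ioi_of_lt (a := -A - 1) (c := 0) (m := 1)
    (by linarith) (by norm_num)) hmeas ?_
  filter_upwards [ae_restrict_mem measurableSet_Ioi] with t ht
  have ht : 0 < t := ht
  rw [Real.norm_of_nonneg (by positivity), Real.rpow_sub_one (by positivity)]
  refine div_le_div_of_nonneg_right ?_ (by positivity)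
  rw [Real.rpow_def_of_pos (by positivity : 0 < t + 1)]
  refine Real.exp_le_exp.2 ?_
  have h1 : 0 ≤ t * N₀ * r₀ ^ η / P := by positivity
  have h2 := mul_le_mul_of_nonneg_left (mul_log_one_add_le_mul_realHyp2F1 hη ht.le)
    (by positivity : 0 ≤ 2 * Real.pi * lam * r₀ ^ 2 / (η - 2))
  have h3 : 2 * Real.pi * lam * r₀ ^ 2 / (η - 2) * ((1 - 2 / η) * Real.log (1 + t)) =
      A * Real.log (t + 1) := by
    rw [hA, add_comm 1 t]
    ring
  have h4 : 2 * Real.pi * lam * r₀ ^ 2 / (η - 2) *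
      (t * realHyp2F1 1 (1 - 2 / η) (2 - 2 / η) (-t)) =
      2 * Real.pi * lam * t * r₀ ^ 2 / (η - 2) *
        realHyp2F1 1 (1 - 2 / η) (2 - 2 / η) (-t) := by ring
  rw [h3, h4] at h2
  linarith

/-- Layer cake formula for the rate: `𝔼[log (1 + Υ)] = ∫₀^∞ ℙ(Υ ≥ t) / (1 + t) dt`. -/
theorem IsDownlinkNetwork.lintegral_log_one_add_sinr (hnet : IsDownlinkNetwork μ lam r₀ X h)
    (hlam : 0 < lam) (hr₀ : 0 < r₀) (hP : 0 < P) (hN₀ : 0 ≤ N₀) (hη : 2 < η) :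
    ∫⁻ ω, ENNReal.ofReal (Real.log (1 + sinr P N₀ η X h ω)) ∂μ =
      ENNReal.ofReal (∫ t in Ioi (0 : ℝ), Real.exp (-(t * N₀ * r₀ ^ η / P) -
        2 * Real.pi * lam * t * r₀ ^ 2 / (η - 2) *
          realHyp2F1 1 (1 - 2 / η) (2 - 2 / η) (-t)) / (t + 1)) := by
  have hcont : ∀ x : ℝ, 0 ≤ x → ContinuousOn (fun t : ℝ => (t + 1)⁻¹) (uIcc 0 x) := by
    intro x hx
    refine ContinuousOn.inv₀ (by fun_prop) fun t ht => ?_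
    rw [uIcc_of_le hx] at ht
    linarith [ht.1]
  have hlog : ∀ x : ℝ, 0 ≤ x → ∫ t in (0 : ℝ)..x, (t + 1)⁻¹ = Real.log (1 + x) := by
    intro x hx
    rw [intervalIntegral.integral_eq_sub_of_hasDerivAt (f := fun t => Real.log (t + 1))]
    · simp [add_comm]
    · intro t ht
      rw [uIcc_of_le hx] at ht
      simpa using ((hasDerivAt_id t).add_const 1).log (by simp only [id]; linarith [ht.1])
    · exact (hcont x hx).intervalIntegrable
  have hcake := lintegral_comp_eq_lintegral_meas_le_mul μ (f := sinr P N₀ η X h)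
    (g := fun t => (t + 1)⁻¹) (Filter.Eventually.of_forall fun ω => sinr_nonneg hP hN₀ η X h ω)
    (hnet.measurable_sinr P N₀ η).aemeasurable
    (fun t ht => (hcont t ht.le).intervalIntegrable)
    (by
      filter_upwards [ae_restrict_mem measurableSet_Ioi] with t ht
      have : 0 < t := ht
      positivity)
  simp_rw [hlog _ (sinr_nonneg hP hN₀ η X h _)] at hcake
  rw [hcake, ofReal_integral_eq_lintegral_ofReal
    (hnet.integrableOn_coverage_div hlam hr₀ hP hN₀ hη)]
  · refine setLIntegral_congr_fun measurableSet_Ioi fun t ht => ?_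
    have ht : 0 < t := ht
    rw [hnet.measure_le_sinr hlam hr₀ hP hN₀ hη ht.le, ← ENNReal.ofReal_mul (Real.exp_pos _).le,
      ← div_eq_mul_inv]
  · filter_upwards [ae_restrict_mem measurableSet_Ioi] with t ht
    have : 0 < t := ht
    simp only [Pi.zero_apply]
    positivity

theorem IsDownlinkNetwork.integrable_log_one_add_sinr (hnet : IsDownlinkNetwork μ lam r₀ X h)
    (hlam : 0 < lam) (hr₀ : 0 < r₀) (hP : 0 < P) (hN₀ : 0 ≤ N₀) (hη : 2 < η) :
    Integrable (fun ω => Real.log (1 + sinr P N₀ η X h ω)) μ := by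
  refine ⟨(((hnet.measurable_sinr P N₀ η).const_add 1).log).aestronglyMeasurable, ?_⟩
  rw [hasFiniteIntegral_iff_ofReal (Filter.Eventually.of_forall fun ω =>
      Real.log_nonneg (le_add_of_nonneg_right (sinr_nonneg hP hN₀ η X h ω))),
    hnet.lintegral_log_one_add_sinr hlam hr₀ hP hN₀ hη]
  exact ENNReal.ofReal_lt_top

theorem IsDownlinkNetwork.ergodicRate_eq (hnet : IsDownlinkNetwork μ lam r₀ X h)
    (hlam : 0 < lam) (hr₀ : 0 < r₀) (hP : 0 < P) (hN₀ : 0 ≤ N₀) (hη : 2 < η) :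
    ergodicRate μ P N₀ η X h = ∫ t in Ioi (0 : ℝ), Real.exp (-(t * N₀ * r₀ ^ η / P) -
      2 * Real.pi * lam * t * r₀ ^ 2 / (η - 2) *
        realHyp2F1 1 (1 - 2 / η) (2 - 2 / η) (-t)) / (t + 1) := by
  rw [ergodicRate, integral_eq_lintegral_of_nonneg_ae
    (Filter.Eventually.of_forall fun ω =>
      Real.log_nonneg (le_add_of_nonneg_right (sinr_nonneg hP hN₀ η X h ω)))
    (hnet.integrable_log_one_add_sinr hlam hr₀ hP hN₀ hη).1,
    hnet.lintegral_log_one_add_sinr hlam hr₀ hP hN₀ hη, ENNReal.toReal_ofReal]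
  refine setIntegral_nonneg measurableSet_Ioi fun t ht => ?_
  have : 0 < t := ht
  positivity

end Network

/-- For `η = 4` the logarithm of the coverage probability is elementary. -/
theorem coverage_exponent_four (lam r₀ P N₀ : ℝ) {T : ℝ} (hT : 0 ≤ T) :
    -(T * N₀ * r₀ ^ (4 : ℝ) / P) - 2 * Real.pi * lam * T * r₀ ^ 2 / (4 - 2) *
        realHyp2F1 1 (1 - 2 / 4) (2 - 2 / 4) (-T) =
      -(T * N₀ * r₀ ^ 4 / P) - Real.pi * lam * √T * r₀ ^ 2 * Real.arctan √T := by
  have h4 : r₀ ^ (4 : ℝ) = r₀ ^ 4 := by exact_mod_cast Real.rpow_natCast r₀ 4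
  rw [h4]
  linear_combination -(Real.pi * lam * r₀ ^ 2) * mul_realHyp2F1_half_eq_arctan hT

theorem mainTheorem2 {Ω : Type*} [MeasurableSpace Ω] (μ : Measure Ω) [IsProbabilityMeasure μ]
    (lam r₀ P N₀ η : ℝ) (hlam : 0 < lam) (hr₀ : 0 < r₀) (hP : 0 < P) (hN₀ : 0 ≤ N₀) (hη : 2 < η)
    (X : ℕ → Ω → EuclideanSpace ℝ (Fin 2)) (h : ℕ → Ω → ℂ)
    (hnet : IsDownlinkNetwork μ lam r₀ X h) :
    -- the interference is almost surely a convergent sum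
    (∀ᵐ ω ∂μ, Summable fun k : ℕ => receivedPower P η X h (k + 1) ω) ∧
    -- outage probability
    (∀ T : ℝ, 0 ≤ T →
      outageProbability μ P N₀ η X h T =
        1 - Real.exp (-(T * N₀ * r₀ ^ η / P) -
          2 * Real.pi * lam * T * r₀ ^ 2 / (η - 2) *
            realHyp2F1 1 (1 - 2 / η) (2 - 2 / η) (-T))) ∧
    (η = 4 → ∀ T : ℝ, 0 ≤ T →
      outageProbability μ P N₀ η X h T =
        1 - Real.exp (-(T * N₀ * r₀ ^ 4 / P) -
          Real.pi * lam * √T * r₀ ^ 2 * Real.arctan √T)) ∧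
    -- ergodic rate
    Integrable (fun ω => Real.log (1 + sinr P N₀ η X h ω)) μ ∧
    IntegrableOn (fun t : ℝ => Real.exp (-(t * N₀ * r₀ ^ η / P) -
          2 * Real.pi * lam * t * r₀ ^ 2 / (η - 2) *
            realHyp2F1 1 (1 - 2 / η) (2 - 2 / η) (-t)) / (t + 1)) (Ioi 0) ∧
    ergodicRate μ P N₀ η X h =
      ∫ t in Ioi (0 : ℝ), Real.exp (-(t * N₀ * r₀ ^ η / P) -
          2 * Real.pi * lam * t * r₀ ^ 2 / (η - 2) *
            realHyp2F1 1 (1 - 2 / η) (2 - 2 / η) (-t)) / (t + 1) ∧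
    (η = 4 →
      ergodicRate μ P N₀ η X h =
        ∫ t in Ioi (0 : ℝ), Real.exp (-(t * N₀ * r₀ ^ 4 / P) -
          Real.pi * lam * √t * r₀ ^ 2 * Real.arctan √t) / (t + 1)) := by
  refine ⟨?_, fun T hT => hnet.outageProbability_eq hlam hr₀ hP hN₀ hη hT, ?_,
    hnet.integrable_log_one_add_sinr hlam hr₀ hP hN₀ hη,
    hnet.integrableOn_coverage_div hlam hr₀ hP hN₀ hη,
    hnet.ergodicRate_eq hlam hr₀ hP hN₀ hη, ?_⟩
  · filter_upwards [hnet.ae_normalizedInterference_ne_top hlam hr₀ hη] with ω hω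
    exact summable_receivedPower P hω
  · rintro rfl T hT
    rw [hnet.outageProbability_eq hlam hr₀ hP hN₀ hη hT, coverage_exponent_four _ _ _ _ hT]
  · rintro rfl
    rw [hnet.ergodicRate_eq hlam hr₀ hP hN₀ hη]
    refine setIntegral_congr_fun measurableSet_Ioi fun t ht => ?_
    rw [coverage_exponent_four _ _ _ _ (le_of_lt ht)]
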